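/- For a nonprincipal ultrafilter $\mu$ on $\omega=\mathbb N$, let ${}^*\mathbb R=\prod_\mu\mathbb R$ and ${}^*\mathbb N=\prod_\mu\mathbb N$ be the ultrapowers, let $\alpha=(n:n\in\omega)_\mu\in{}^*\mathbb R$ and $\rho=e^{-\alpha}$. The Robinson field of $\mu$ is the quotient ${}^\rho\mathbb R_\mu=M_0/M_1$ of the ring $M_0=\{t\in{}^*\mathbb R : |t|<\rho^{-k}\text{ for some }k\in\mathbb N\}$ by its maximal ideal $M_1=\{t\in{}^*\mathbb R : |t|<\rho^{k}\text{ for all }k\in\mathbb N\}$. Let $L_\mu=\{x\in{}^*\mathbb N : n<x\text{ for all }n\in\omega\}$ be the linearly ordered set of elements of ${}^*\mathbb N$ above $\omega$. **Theorem.** Assume that the continuum hypothesis fails, i.e. $2^{\aleph_0}\neq\aleph_1$. Then there are exactly $2^{2^{\aleph_0}}$ Robinson fields ${}^\rho\mathbb R_\mu$ up to isomorphism of fields. Moreover, there is a set $S$ of nonprincipal ultrafilters on $\omega$ with $|S|=2^{2^{\aleph_0}}$ such that for all distinct $\mu,\nu\in S$ the Robinson fields ${}^\rho\mathbb R_\mu$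 and ${}^\rho\mathbb R_\nu$ are not isomorphic as fields, and no nonempty initial segment of $L_\mu$ is order-isomorphic to a nonempty initial segment of $L_\nu$. -/

import Mathlib

noncomputable section

/-- The nonprincipal ultrafilters on `ω = ℕ`. -/
def NonprincipalUltrafilter : Type :=
  {μ : Ultrafilter ℕ // ∀ n : ℕ, μ ≠ pure n}

namespace Robinson

/-- The ultrapower `*ℝ = ∏_μ ℝ`, with its ordered field structure. -/
abbrev HyperR (μ : NonprincipalUltrafilter) : Type :=
  Filter.Germ (μ.1 : Filter ℕ) ℝ

/-- The ultrapower `*ℕ = ∏_μ ℕ`, with its linear order. -/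
abbrev HyperN (μ : NonprincipalUltrafilter) : Type :=
  Filter.Germ (μ.1 : Filter ℕ) ℕ

/-- The infinite number `α = (n : n ∈ ω)_μ`. -/
def alpha (μ : NonprincipalUltrafilter) : HyperR μ :=
  ((fun n : ℕ => (n : ℝ)) : ℕ → ℝ)

/-- The infinitesimal `ρ = e^{-α}`. -/
def rho (μ : NonprincipalUltrafilter) : HyperR μ :=
  Filter.Germ.map (fun x : ℝ => Real.exp (-x)) (alpha μ)

theorem rho_pos (μ : NonprincipalUltrafilter) : 0 < rho μ :=
  Filter.Germ.coe_pos.2 (Filter.Eventually.of_forall fun _ => Real.exp_pos _)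

theorem le_cofinite (μ : NonprincipalUltrafilter) :
    (μ.1 : Filter ℕ) ≤ Filter.cofinite := by
  rcases μ.1.le_cofinite_or_eq_pure with h | ⟨n, hn⟩
  · exact h
  · exact absurd hn (μ.2 n)

theorem two_mul_rho_le (μ : NonprincipalUltrafilter) : 2 * rho μ ≤ 1 := by
  have h : ∀ᶠ n : ℕ in (μ.1 : Filter ℕ), 2 * Real.exp (-(n : ℝ)) ≤ 1 := by
    apply le_cofinite μ
    rw [Nat.cofinite_eq_atTop]
    filter_upwards [Filter.eventually_ge_atTop 1] with n hn
    have h1 : (1 : ℝ) ≤ n := by exact_mod_cast hn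
    have h2 : (2 : ℝ) ≤ Real.exp n := by
      have := Real.add_one_le_exp (n : ℝ)
      linarith
    rw [Real.exp_neg]
    have h3 : 0 < Real.exp (n : ℝ) := Real.exp_pos _
    rw [← div_eq_mul_inv, div_le_one h3]
    exact h2
  exact Filter.Germ.coe_le.2 h

theorem rho_le_one (μ : NonprincipalUltrafilter) : rho μ ≤ 1 := by
  linarith [two_mul_rho_le μ, rho_pos μ]

theorem inv_pow_mono (μ : NonprincipalUltrafilter) {k l : ℕ} (h : k ≤ l) :
    ((rho μ)⁻¹) ^ k ≤ ((rho μ)⁻¹) ^ l :=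
  pow_le_pow_right₀ ((one_le_inv₀ (rho_pos μ)).2 (rho_le_one μ)) h

theorem two_mul_inv_pow_le (μ : NonprincipalUltrafilter) (k : ℕ) :
    2 * ((rho μ)⁻¹) ^ k ≤ ((rho μ)⁻¹) ^ (k + 1) := by
  have h0 := rho_pos μ
  have h2 : 2 ≤ (rho μ)⁻¹ := (le_inv_comm₀ two_pos h0).2 (by
    have := two_mul_rho_le μ
    rw [← one_div, le_div_iff₀ two_pos]
    linarith)
  rw [pow_succ, mul_comm]
  exact mul_le_mul_of_nonneg_left h2 (pow_nonneg (inv_nonneg.2 h0.le) k)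

/-- `M₀ = {t ∈ *ℝ : |t| < ρ^{-k} for some k ∈ ℕ}`. -/
def M0 (μ : NonprincipalUltrafilter) : Subring (HyperR μ) where
  carrier := {t | ∃ k : ℕ, |t| < ((rho μ)⁻¹) ^ k}
  zero_mem' := ⟨0, by simp⟩
  one_mem' := ⟨1, by
    have h := two_mul_inv_pow_le μ 0
    rw [pow_zero, zero_add] at h
    rw [abs_one]
    linarith⟩
  add_mem' := by
    rintro a b ⟨k, hk⟩ ⟨l, hl⟩
    refine ⟨max k l + 1, ?_⟩
    have h1 := inv_pow_mono μ (le_max_left k l)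
    have h2 := inv_pow_mono μ (le_max_right k l)
    have h3 := two_mul_inv_pow_le μ (max k l)
    have h4 := abs_add_le a b
    linarith
  neg_mem' := by
    rintro a ⟨k, hk⟩
    exact ⟨k, by rwa [abs_neg]⟩
  mul_mem' := by
    rintro a b ⟨k, hk⟩ ⟨l, hl⟩
    refine ⟨k + l, ?_⟩
    rw [abs_mul, pow_add]
    exact mul_lt_mul'' hk hl (abs_nonneg a) (abs_nonneg b)

/-- `M₁ = {t ∈ *ℝ : |t| < ρ^k for all k ∈ ℕ}`, an ideal of `M₀` (which contains it). -/
def M1 (μ : NonprincipalUltrafilter) : Ideal (M0 μ) where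
  carrier := {t | ∀ k : ℕ, |(t : HyperR μ)| < (rho μ) ^ k}
  zero_mem' := fun k => by
    simpa using pow_pos (rho_pos μ) k
  add_mem' := by
    intro a b ha hb k
    have h1 := ha (k + 1)
    have h2 := hb (k + 1)
    have h3 := abs_add_le (a : HyperR μ) (b : HyperR μ)
    have h4 : 2 * (rho μ) ^ (k + 1) ≤ (rho μ) ^ k := by
      have h5 := mul_le_mul_of_nonneg_left (two_mul_rho_le μ) (pow_nonneg (rho_pos μ).le k)
      rw [pow_succ]
      linarith
    change |(a : HyperR μ) + (b : HyperR μ)| < (rho μ) ^ k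
    linarith
  smul_mem' := by
    rintro ⟨c, l, hl⟩ a ha k
    have h1 := ha (k + l)
    have h0 := rho_pos μ
    change |c * (a : HyperR μ)| < (rho μ) ^ k
    rw [abs_mul]
    have h2 := mul_lt_mul'' hl h1 (abs_nonneg _) (abs_nonneg _)
    have h3 : ((rho μ)⁻¹) ^ l * (rho μ) ^ (k + l) = (rho μ) ^ k := by
      rw [pow_add, mul_comm, mul_assoc, ← mul_pow, mul_inv_cancel₀ h0.ne', one_pow, mul_one]
    rwa [h3] at h2

theorem mem_M0_of_mem (μ : NonprincipalUltrafilter) (t : HyperR μ)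
    (ht : ∀ k : ℕ, |t| < (rho μ) ^ k) : t ∈ M0 μ := by
  obtain ⟨k, hk⟩ := (M0 μ).one_mem
  rw [abs_one] at hk
  have h := ht 0
  rw [pow_zero] at h
  exact ⟨k, h.trans hk⟩

instance M1_isMaximal (μ : NonprincipalUltrafilter) : (M1 μ).IsMaximal := by
  rw [Ideal.isMaximal_iff]
  constructor
  · intro h
    have h1 : |(1 : HyperR μ)| < (rho μ) ^ 0 := h 0
    simp at h1
  · intro J x _ hx hxJ
    have hx' : ¬ ∀ k : ℕ, |(x : HyperR μ)| < (rho μ) ^ k := hx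
    push Not at hx'
    obtain ⟨k, hk⟩ := hx'
    have h0 := pow_pos (rho_pos μ) k
    have hpos : 0 < |(x : HyperR μ)| := h0.trans_le hk
    have hinv : (x : HyperR μ)⁻¹ ∈ M0 μ := by
      refine ⟨k + 1, ?_⟩
      have h1 : |(x : HyperR μ)⁻¹| ≤ ((rho μ)⁻¹) ^ k := by
        rw [abs_inv, inv_pow]
        exact inv_anti₀ h0 hk
      have h2 := two_mul_inv_pow_le μ k
      have h3 := pow_pos (inv_pos.2 (rho_pos μ)) k
      linarith
    have h1 : (⟨(x : HyperR μ)⁻¹, hinv⟩ : M0 μ) * x = 1 :=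
      Subtype.ext (inv_mul_cancel₀ (abs_pos.1 hpos))
    rw [← h1]
    exact J.mul_mem_left _ hxJ

end Robinson

/-- Robinson's field `^ρℝ = M₀/M₁` of the ultrafilter `μ`, where `ρ = e^{-α}`, `α = (n)_μ`. -/
abbrev RobinsonField (μ : NonprincipalUltrafilter) : Type :=
  Robinson.M0 μ ⧸ Robinson.M1 μ

instance instFieldRobinsonField (μ : NonprincipalUltrafilter) : Field (RobinsonField μ) :=
  Ideal.Quotient.field (Robinson.M1 μ)

/-- Two ultrafilters are related when their Robinson fields are isomorphic as fields. -/
def robinsonSetoid : Setoid NonprincipalUltrafilter where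
  r μ ν := Nonempty (RobinsonField μ ≃+* RobinsonField ν)
  iseqv :=
    { refl := fun _ => ⟨RingEquiv.refl _⟩
      symm := fun ⟨e⟩ => ⟨e.symm⟩
      trans := fun ⟨e⟩ ⟨f⟩ => ⟨e.trans f⟩ }

/-- The isomorphism classes of Robinson fields. -/
def RobinsonIsoClass : Type := Quotient robinsonSetoid

/-- The part of the ultrapower `*ℕ = ∏_μ ℕ` above `ω`: its infinite elements. -/
abbrev AboveOmega (μ : NonprincipalUltrafilter) : Type :=
  {x : Robinson.HyperN μ // ∀ n : ℕ, (Filter.Germ.const n : Robinson.HyperN μ) < x}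

/-- `L₁` and `L₂` agree near their lower ends: some nonempty initial segment of `L₁` is
order-isomorphic to some nonempty initial segment of `L₂`. -/
def HaveIsoInitialSegments (L₁ L₂ : Type) [LinearOrder L₁] [LinearOrder L₂] : Prop :=
  ∃ (s : Set L₁) (t : Set L₂), s.Nonempty ∧ t.Nonempty ∧ IsLowerSet s ∧ IsLowerSet t ∧
    Nonempty (s ≃o t)

end

/-! The upper bound is the number of ultrafilters on `ℕ`. For the lower bound, `2 ^ 𝔠` families of
bits are coded in the orders `AboveOmega μ`, in a way that any nonempty initial segment remembers; a
field isomorphism then has to respect the code.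

Coding. In a `Ladder`, `c` is a coinitial chain; for `δ` of cofinality `ω₁` the cut below `c` at `δ`
has a cofinal chain `h δ`; for `ε` of cofinality `ω₁` the cut above `h δ` at `ε` has coinitiality
`ω₁` or `ω₂`, which is one bit. An isomorphism of initial segments matches these cuts at all closure
points of suitable functions, so the bits agree modulo clubs (`Ladder.bits_eq`). If each bit is
repeated along a stationary set (`exists_stationary_coloring`), all bits are recovered. The two
levels allow for singular `𝔠`: the stationary sets live on regular cardinals, and a regular number
of regular cardinals has sum at least `𝔠` (`exists_regular_family`). Failure of CH provides `ω₂ ≤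
𝔠`.

Realization. An explicit order of size at most `𝔠` is embedded above `ω` in an ultrapower
(`exists_ultrafilter`) by means of independent functions `g s`. Modulo a maximal filter `D` keeping
them independent, finite assignments of values to the `g s` act as dense forcing conditions, and
each function has a countable support. The ultrafilter is built by recursion along stages, from the
top of the order downwards: values of functions with earlier support are kept, and the new `g s` go
below all nonstandard ones among these; within a stage the `g s` behave like an iterated product of
ultrafilters (`frequently_requirements`, `exists_extension`). As a result a function lies between `g
a` and `g b`, for linked `a < b`, only if its support meets `[a, b]`. Countable supports cannot fill
cuts of uncountable cofinality, so these cuts keep the shape given by the order.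

Fields. Nonnegativity in the Robinson field means being a square, so field isomorphisms preserve
order; taking integer parts yields an isomorphism between the initial segments of infinite
hypernatural numbers that lie in `M₀` (`haveIsoInitialSegments_of_ringEquiv`). -/

open Cardinal Set Filter

/-! ### Stationary sets on regular cardinals -/

/-- A well-order of an uncountable regular cardinal type. -/
class UncountableRegular (α : Type) [LinearOrder α] : Prop extends WellFoundedLT α where
  exists_gt_of_mk_lt : ∀ s : Set α, #s < #α → ∃ b, ∀ x ∈ s, x < b
  mk_Iio_lt : ∀ b : α, #(Iio b) < #α
  aleph0_lt : ℵ₀ < #α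

theorem UncountableRegular.of_isRegular {κ : Cardinal.{0}} (h : κ.IsRegular) (h0 : ℵ₀ < κ) :
    UncountableRegular κ.ord.ToType where
  exists_gt_of_mk_lt s hs := by
    rw [Cardinal.mk_toType, Cardinal.card_ord] at hs
    by_contra! hcon
    have hc : IsCofinal s := fun b => by
      obtain ⟨x, hx, hbx⟩ := hcon b
      exact ⟨x, hx, hbx⟩
    have := Order.cof_le hc
    rw [Ordinal.cof_toType, h.cof_ord] at this
    exact absurd hs (not_lt.2 this)
  mk_Iio_lt b := by
    rw [Cardinal.mk_toType, Cardinal.card_ord]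
    have := Cardinal.mk_Iio_lt b
      (by rw [Cardinal.mk_toType, Cardinal.card_ord, Ordinal.type_toType])
    rwa [Cardinal.mk_toType, Cardinal.card_ord] at this
  aleph0_lt := by
    rwa [Cardinal.mk_toType, Cardinal.card_ord]

/-- The well-order of type `ω₁`. -/
abbrev Omega1 : Type := (ℵ_ 1).ord.ToType

/-- The well-order of type `ω₂`. -/
abbrev Omega2 : Type := (ℵ_ 2).ord.ToType

theorem mk_Omega1 : #Omega1 = ℵ_ 1 := by rw [Cardinal.mk_toType, Cardinal.card_ord]

theorem mk_Omega2 : #Omega2 = ℵ_ 2 := by rw [Cardinal.mk_toType, Cardinal.card_ord]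

theorem isRegular_aleph_two : (ℵ_ 2).IsRegular := by
  rw [← one_add_one_eq_two]
  exact isRegular_aleph_add_one 1

instance : UncountableRegular Omega1 :=
  .of_isRegular isRegular_aleph_one aleph0_lt_aleph_one

theorem aleph_one_lt_aleph_two : ℵ_ 1 < (ℵ_ 2 : Cardinal.{0}) :=
  aleph_lt_aleph.2 one_lt_two

instance : UncountableRegular Omega2 :=
  .of_isRegular isRegular_aleph_two (aleph0_lt_aleph_one.trans aleph_one_lt_aleph_two)

namespace UncountableRegular

variable {α : Type} [LinearOrder α] [UncountableRegular α]

theorem exists_gt_range {ι : Type} (f : ι → α) (h : #ι < #α) : ∃ b, ∀ i, f i < b := by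
  obtain ⟨b, hb⟩ := exists_gt_of_mk_lt (range f) (mk_range_le.trans_lt h)
  exact ⟨b, fun i => hb _ ⟨i, rfl⟩⟩

theorem exists_gt_of_countable {s : Set α} (hs : s.Countable) : ∃ b, ∀ x ∈ s, x < b :=
  exists_gt_of_mk_lt s ((le_aleph0_iff_set_countable.2 hs).trans_lt (aleph0_lt (α := α)))

instance : Nonempty α := by
  obtain ⟨b, -⟩ := exists_gt_of_countable (α := α) countable_empty
  exact ⟨b⟩

instance : NoMaxOrder α :=
  ⟨fun a => by
    obtain ⟨b, hb⟩ := exists_gt_of_countable (α := α) (countable_singleton a)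
    exact ⟨b, hb a rfl⟩⟩

theorem mk_Iic_lt (b : α) : #(Iic b) < #α := by
  obtain ⟨c, hc⟩ := exists_gt b
  exact (mk_le_mk_of_subset fun x (hx : x ≤ b) => hx.trans_lt hc).trans_lt (mk_Iio_lt c)

theorem mk_eq_of_unbounded {s : Set α} (hs : ∀ b, ∃ x ∈ s, b ≤ x) : #s = #α := by
  refine (mk_set_le s).antisymm (not_lt.1 fun h => ?_)
  obtain ⟨b, hb⟩ := exists_gt_of_mk_lt s h
  obtain ⟨x, hx, hbx⟩ := hs b
  exact (hb x hx).not_ge hbx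

/-- Stationary sets, tested against the clubs of closure points of functions. -/
def Stat (S : Set α) : Prop := ∀ h : α → α, ∃ δ ∈ S, ∀ i < δ, h i < δ

/-- `δ` has cofinality `ω₁`. -/
def Cof1 {α : Type} [LinearOrder α] (δ : α) : Prop :=
  ∃ e : Omega1 → α, StrictMono e ∧ (∀ ξ, e ξ < δ) ∧ ∀ i < δ, ∃ ξ, i < e ξ

theorem Cof1.exists_gt_of_countable {α : Type} [LinearOrder α] {δ : α} (h : Cof1 δ)
    {s : Set α} (hs : s.Countable)
    (hδ : ∀ x ∈ s, x < δ) : ∃ b < δ, ∀ x ∈ s, x < b := by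
  obtain ⟨e, hmono, heδ, he⟩ := h
  have : Countable s := hs.to_subtype
  choose ξ hξ using fun x : s => he x (hδ x x.2)
  obtain ⟨b, hb⟩ := UncountableRegular.exists_gt_of_countable (countable_range ξ)
  exact ⟨e b, heδ b, fun x hx =>
    (hξ ⟨x, hx⟩).trans (hmono (hb _ ⟨⟨x, hx⟩, rfl⟩))⟩

theorem Cof1.exists_lt {α : Type} [LinearOrder α] {δ : α} (h : Cof1 δ) : ∃ b, b < δ := by
  obtain ⟨b, hb, -⟩ := h.exists_gt_of_countable countable_empty (by simp)
  exact ⟨b, hb⟩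

/-- The supremum of an increasing `ω₁`-sequence, each term of which bounds `h` on everything up to
the earlier terms, is a closure point of `h`. The sequence is bounded because `ℵ₁ < #α`. -/
theorem stat_cof1 (h1 : ℵ_ 1 < #α) : Stat {δ : α | Cof1 δ} := by
  intro h
  have step : ∀ (ξ : Omega1) (e : ∀ η : Omega1, η < ξ → α),
      ∃ b, (∀ η hη, e η hη < b) ∧ ∀ η hη, ∀ j ≤ e η hη, h j < b := by
    intro ξ e
    have hI : #(Iio ξ) < #α := by
      refine (mk_Iio_lt ξ).trans ?_
      rwa [mk_Omega1]
    obtain ⟨b, hb⟩ := exists_gt_range (fun η : Iio ξ => e η.1 η.2) hI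
    obtain ⟨c, hc⟩ := exists_gt_range (fun j : Iic b => h j) (mk_Iic_lt b)
    refine ⟨max b c, fun η hη => (hb ⟨η, hη⟩).trans_le (le_max_left _ _), fun η hη j hj => ?_⟩
    exact (hc ⟨j, hj.trans (hb ⟨η, hη⟩).le⟩).trans_le (le_max_right _ _)
  choose F hF1 hF2 using step
  let e : Omega1 → α := wellFounded_lt.fix F
  have he : ∀ ξ, e ξ = F ξ fun η _ => e η := fun ξ => wellFounded_lt.fix_eq F ξ
  have hmono : StrictMono e := fun η ξ hη => by
    rw [he ξ]; exact hF1 ξ (fun η _ => e η) η hη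
  obtain ⟨B, hB⟩ := exists_gt_range e (by rwa [mk_Omega1])
  obtain ⟨δ, hδ, hmin⟩ := (wellFounded_lt (α := α)).has_min {b | ∀ ξ, e ξ < b} ⟨B, hB⟩
  have hcof : ∀ i < δ, ∃ ξ, i < e ξ := by
    intro i hi
    by_contra! hcon
    refine hmin i (fun ξ => ?_) hi
    obtain ⟨η, hη⟩ := exists_gt ξ
    exact (hmono hη).trans_le (hcon η)
  refine ⟨δ, ⟨e, hmono, hδ, hcof⟩, fun i hi => ?_⟩
  obtain ⟨ξ, hξ⟩ := hcof i hi
  obtain ⟨η, hη⟩ := exists_gt ξ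
  refine lt_trans ?_ (hδ η)
  rw [he η]
  exact hF2 η (fun η _ => e η) ξ hη i hξ.le

/-- Fodor's lemma. -/
theorem Stat.exists_fiber {S : Set α} (hS : Stat S) (f : α → α) (hf : ∀ δ ∈ S, f δ < δ) :
    ∃ γ, Stat {δ | δ ∈ S ∧ f δ = γ} := by
  by_contra! hcon
  simp only [Stat, not_forall, not_exists, not_and] at hcon
  choose h hh using hcon
  -- Diagonal intersection: a closure point of `H` is closed under every `h γ` with `γ` below it.
  have hb : ∀ k : α, ∃ b, ∀ p : Iic k × Iic k, h p.1 p.2 < b := fun k => by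
    refine exists_gt_range _ ?_
    rw [← mul_def]
    exact mul_lt_of_lt aleph0_lt.le (mk_Iic_lt k) (mk_Iic_lt k)
  choose H hH using hb
  obtain ⟨δ, hδ, hcl⟩ := hS H
  obtain ⟨j, hj, hcon⟩ := hh (f δ) δ ⟨hδ, rfl⟩
  exact hcon <| (hH (max (f δ) j) (⟨f δ, le_max_left _ _⟩, ⟨j, le_max_right _ _⟩)).trans
    (hcl _ (max_lt (hf δ hδ) hj))

/-- Solovay's splitting of the points of cofinality `ω₁` into stationary sets. -/
theorem exists_stationary_coloring (h1 : ℵ_ 1 < #α) :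
    ∃ c : α → α, ∀ γ, Stat {δ | Cof1 δ ∧ c δ = γ} := by
  classical
  let e : α → Omega1 → α := fun δ => if h : Cof1 δ then h.choose else fun _ => δ
  have he : ∀ δ, Cof1 δ → (∀ ξ, e δ ξ < δ) ∧ ∀ i < δ, ∃ ξ, i < e δ ξ := by
    intro δ h
    simp only [e, dif_pos h]
    exact h.choose_spec.2
  -- Otherwise each `ξ` has a bound `η ξ` that `e δ ξ` exceeds only off a club. The `ℵ₁` many bounds
  -- lie below one `b`, and the `ℵ₁` many clubs meet in one, in which a suitable `δ > b` of
  -- cofinality `ω₁` has its chain `e δ` confined below `b`.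
  have key : ∃ ξ, ∀ η, Stat {δ | Cof1 δ ∧ η ≤ e δ ξ} := by
    by_contra! hcon
    choose η hη using hcon
    simp only [Stat, not_forall, not_exists, not_and] at hη
    choose h hh using hη
    obtain ⟨b, hb⟩ := exists_gt_range η (by rwa [mk_Omega1])
    have hH : ∀ j, ∃ c, ∀ ξ, h ξ j < c := fun j =>
      exists_gt_range (fun ξ => h ξ j) (by rwa [mk_Omega1])
    choose H hH using hH
    obtain ⟨δ, hδ, hcl⟩ := stat_cof1 h1 fun j => max b (H j)
    obtain ⟨i, hi⟩ := hδ.exists_lt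
    obtain ⟨ξ, hξ⟩ := (he δ hδ).2 b ((le_max_left _ _).trans_lt (hcl i hi))
    obtain ⟨j, hj, hcon⟩ := hh ξ δ ⟨hδ, ((hb ξ).trans hξ).le⟩
    exact hcon <| ((hH j ξ).trans_le (le_max_right _ _)).trans (hcl j hj)
  obtain ⟨ξ, hξ⟩ := key
  let Γ : Set α := {γ | Stat {δ | Cof1 δ ∧ e δ ξ = γ}}
  have hΓ : #Γ = #α := by
    refine mk_eq_of_unbounded fun η => ?_
    obtain ⟨γ, hγ⟩ := (hξ η).exists_fiber (fun δ => e δ ξ) fun δ hδ => (he δ hδ.1).1 ξ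
    -- Every point is a closure point of `id`, so this merely picks an element of the fiber.
    obtain ⟨δ, hδ, -⟩ := hγ id
    refine ⟨γ, fun h => ?_, hδ.2 ▸ hδ.1.2⟩
    obtain ⟨δ, hδ, hcl⟩ := hγ h
    exact ⟨δ, ⟨hδ.1.1, hδ.2⟩, hcl⟩
  obtain ⟨φ⟩ := Cardinal.eq.1 hΓ
  obtain ⟨i⟩ := (inferInstance : Nonempty α)
  refine ⟨fun δ => if h : e δ ξ ∈ Γ then φ ⟨_, h⟩ else i, fun γ h => ?_⟩
  obtain ⟨δ, hδ, hcl⟩ := (φ.symm γ).2 h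
  refine ⟨δ, ⟨hδ.1, ?_⟩, hcl⟩
  have hmem : e δ ξ ∈ Γ := hδ.2 ▸ (φ.symm γ).2
  change dite _ _ _ = γ
  rw [dif_pos hmem, ← Equiv.eq_symm_apply]
  exact Subtype.ext hδ.2

end UncountableRegular

open UncountableRegular

/-! ### Ladders and the invariance of their bits -/

/-- The order types `ω₁` and `ω₂`. -/
def OmegaBit : Bool → Type
  | true => Omega1
  | false => Omega2

noncomputable instance : ∀ b, LinearOrder (OmegaBit b)
  | true => inferInstanceAs (LinearOrder Omega1)
  | false => inferInstanceAs (LinearOrder Omega2)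

instance : ∀ b, UncountableRegular (OmegaBit b)
  | true => inferInstanceAs (UncountableRegular Omega1)
  | false => inferInstanceAs (UncountableRegular Omega2)

/-- A coinitial chain `c` in `L`; chains `h δ` cofinal in the cuts below the limits of
cofinality `ω₁` of `c`; chains `m δ ε`, of type `ω₁` or `ω₂` as `a δ ε` says, coinitial in the cuts
above the limits of cofinality `ω₁` of `h δ`. -/
structure Ladder {X : Type} [LinearOrder X] (Θ : X → Type) [∀ i, LinearOrder (Θ i)]
    (a : ∀ i, Θ i → Bool) (L : Type) [LinearOrder L] where
  c : X → L
  c_anti : StrictAnti c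
  c_coinitial : ∀ y, ∃ i, c i < y
  h : ∀ i, Θ i → L
  h_mono : ∀ i, StrictMono (h i)
  h_lt_c : ∀ i j ε, j < i → h i ε < c j
  h_cofinal : ∀ δ, Cof1 δ → ∀ y, (∀ i < δ, y < c i) → ∃ ε, y < h δ ε
  m : ∀ i ε, OmegaBit (a i ε) → L
  m_anti : ∀ i ε, StrictAnti (m i ε)
  m_lt_c : ∀ i j ε ζ, j < i → m i ε ζ < c j
  h_lt_m : ∀ i ε' ε ζ, ε' < ε → h i ε' < m i ε ζ
  m_coinitial : ∀ i ε, Cof1 ε → ∀ y, (∀ ε' < ε, h i ε' < y) → ∃ ζ, m i ε ζ < y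

/-- Mutually inverse strictly increasing maps between the sets `s` and `t`. -/
structure PartialOrderIso {L L' : Type} [LinearOrder L] [LinearOrder L'] (s : Set L) (t : Set L')
    (f : L → L') (f' : L' → L) : Prop where
  maps : ∀ x ∈ s, f x ∈ t
  maps' : ∀ y ∈ t, f' y ∈ s
  left : ∀ x ∈ s, f' (f x) = x
  right : ∀ y ∈ t, f (f' y) = y
  mono : ∀ x ∈ s, ∀ y ∈ s, x < y → f x < f y
  mono' : ∀ x ∈ t, ∀ y ∈ t, x < y → f' x < f' y

section

variable {L L' : Type} [LinearOrder L] [LinearOrder L'] {s : Set L} {t : Set L'} {f : L → L'}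
  {f' : L' → L}

theorem PartialOrderIso.symm (e : PartialOrderIso s t f f') : PartialOrderIso t s f' f :=
  ⟨e.maps', e.maps, e.right, e.left, e.mono', e.mono⟩

theorem PartialOrderIso.apply_lt (e : PartialOrderIso s t f f') {x : L} {y : L'} (hx : x ∈ s)
    (hy : y ∈ t) (h : x < f' y) : f x < y := by
  have := e.mono x hx _ (e.maps' y hy) h
  rwa [e.right y hy] at this

theorem PartialOrderIso.lt_apply (e : PartialOrderIso s t f f') {x : L} {y : L'} (hx : x ∈ s)
    (hy : y ∈ t) (h : f' y < x) : y < f x := by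
  have := e.mono _ (e.maps' y hy) x hx h
  rwa [e.right y hy] at this

theorem exists_partialOrderIso {s : Set L} {t : Set L'} (hs : s.Nonempty) (ht : t.Nonempty)
    (φ : s ≃o t) : ∃ f f', PartialOrderIso s t f f' := by
  classical
  obtain ⟨x₀, hx₀⟩ := hs
  obtain ⟨y₀, hy₀⟩ := ht
  refine ⟨fun x => if h : x ∈ s then φ ⟨x, h⟩ else y₀,
    fun y => if h : y ∈ t then φ.symm ⟨y, h⟩ else x₀, ?_⟩
  constructor
  · intro x hx; simp [hx]
  · intro x hx; simp [hx]
  · intro x hx; simp [hx]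
  · intro x hx; simp [hx]
  · intro x hx y hy h; simpa [hx, hy] using h
  · intro x hx y hy h; simpa [hx, hy] using h

/-- Regularity of `ω₂`: the `ℵ₁` many indices needed to get below all `p ζ` have an upper bound. -/
theorem not_coinitial_omega1_omega2 {p : Omega1 → L} {q : Omega2 → L} (hq : StrictAnti q)
    (hqp : ∀ ζ, ∃ ξ, q ξ < p ζ) (hpq : ∀ ξ, ∃ ζ, p ζ < q ξ) : False := by
  choose ξ hξ using hqp
  obtain ⟨b, hb⟩ := exists_gt_range ξ (by
    rw [mk_Omega1, mk_Omega2]; exact aleph_one_lt_aleph_two)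
  obtain ⟨ζ, hζ⟩ := hpq b
  exact lt_irrefl _ (((hq (hb ζ)).trans (hξ ζ)).trans hζ)

theorem omegaBit_eq {p q : Bool} {u : OmegaBit p → L} {v : OmegaBit q → L} (hu : StrictAnti u)
    (hv : StrictAnti v) (huv : ∀ ζ, ∃ ξ, u ξ < v ζ) (hvu : ∀ ξ, ∃ ζ, v ζ < u ξ) : p = q := by
  cases p <;> cases q
  · rfl
  · exact (not_coinitial_omega1_omega2 (p := v) (q := u) hu huv hvu).elim
  · exact (not_coinitial_omega1_omega2 (p := u) (q := v) hv hvu huv).elim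
  · rfl

variable {X : Type} [LinearOrder X] {Θ : X → Type} [∀ i, LinearOrder (Θ i)]
  {a b : ∀ i, Θ i → Bool}

theorem Ladder.exists_c_mem (A : Ladder Θ a L) (hs : s.Nonempty) (hl : IsLowerSet s) :
    ∃ i, A.c i ∈ s := by
  obtain ⟨x, hx⟩ := hs
  obtain ⟨i, hi⟩ := A.c_coinitial x
  exact ⟨i, hl hi.le hx⟩

/-- The cut below `c` at `δ`. -/
def Ladder.cut (A : Ladder Θ a L) (δ : X) : Set L := {x | ∀ i < δ, x < A.c i}

theorem Ladder.apply_mem_cut (A : Ladder Θ a L) (B : Ladder Θ b L')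
    (e : PartialOrderIso s t f f') (hl : IsLowerSet s) (hl' : IsLowerSet t) {δ i₀ i₁ : X}
    (hi₀ : A.c i₀ ∈ s) (hi₁ : B.c i₁ ∈ t) (h₀ : i₀ < δ)
    (hδ : ∀ i < δ, ∃ k < δ, A.c k < f' (B.c (max i i₁))) :
    ∀ x ∈ A.cut δ, x ∈ s ∧ f x ∈ B.cut δ := by
  intro x hx
  have hxs : x ∈ s := hl (hx i₀ h₀).le hi₀
  refine ⟨hxs, fun i hi => ?_⟩
  obtain ⟨k, hk, hck⟩ := hδ i hi
  have hmem : B.c (max i i₁) ∈ t := hl' (B.c_anti.antitone (le_max_right _ _)) hi₁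
  exact (e.apply_lt hxs hmem ((hx k hk).trans hck)).trans_le
    (B.c_anti.antitone (le_max_left _ _))

/-- Ladders on orders with isomorphic initial segments have the same bits, modulo clubs. -/
theorem Ladder.bits_eq [UncountableRegular X] [∀ i, UncountableRegular (Θ i)]
    (A : Ladder Θ a L) (B : Ladder Θ b L') (hiso : HaveIsoInitialSegments L L') :
    ∃ H : X → X, ∀ δ, Cof1 δ → (∀ i < δ, H i < δ) →
      ∃ H' : Θ δ → Θ δ, ∀ ε, Cof1 ε → (∀ ε' < ε, H' ε' < ε) → a δ ε = b δ ε := by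
  obtain ⟨s, t, hs, ht, hl, hl', ⟨φ⟩⟩ := hiso
  obtain ⟨f, f', e⟩ := exists_partialOrderIso hs ht φ
  obtain ⟨i₀, hi₀⟩ := A.exists_c_mem hs hl
  obtain ⟨i₁, hi₁⟩ := B.exists_c_mem ht hl'
  -- The maxima keep the arguments of `f` and `f'` inside the initial segments where these maps are
  -- mutually inverse. Closure under `H` makes the two chains interlace below `δ`.
  have step : ∀ i, ∃ k, i₀ ≤ k ∧ i₁ ≤ k ∧ A.c k < f' (B.c (max i i₁)) ∧
      B.c k < f (A.c (max i i₀)) := by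
    intro i
    obtain ⟨k, hk⟩ := A.c_coinitial (f' (B.c (max i i₁)))
    obtain ⟨l, hl⟩ := B.c_coinitial (f (A.c (max i i₀)))
    refine ⟨max (max i₀ i₁) (max k l), by simp, by simp, ?_, ?_⟩
    · exact (A.c_anti.antitone (by simp)).trans_lt hk
    · exact (B.c_anti.antitone (by simp)).trans_lt hl
  choose H hH₀ hH₁ hHA hHB using step
  refine ⟨H, fun δ hδ hcl => ?_⟩
  obtain ⟨i, hi⟩ := hδ.exists_lt
  have h₀ : i₀ < δ := (hH₀ i).trans_lt (hcl i hi)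
  have h₁ : i₁ < δ := (hH₁ i).trans_lt (hcl i hi)
  have hAB := A.apply_mem_cut B e hl hl' hi₀ hi₁ h₀ fun i hi => ⟨H i, hcl i hi, hHA i⟩
  have hBA := B.apply_mem_cut A e.symm hl' hl hi₁ hi₀ h₁ fun i hi => ⟨H i, hcl i hi, hHB i⟩
  have hhA : ∀ ε, A.h δ ε ∈ A.cut δ := fun ε i hi => A.h_lt_c δ i ε hi
  have hhB : ∀ ε, B.h δ ε ∈ B.cut δ := fun ε i hi => B.h_lt_c δ i ε hi
  have step : ∀ ε, ∃ k, f (A.h δ ε) < B.h δ k ∧ f' (B.h δ ε) < A.h δ k := by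
    intro ε
    obtain ⟨k, hk⟩ := B.h_cofinal δ hδ _ (hAB _ (hhA ε)).2
    obtain ⟨l, hl⟩ := A.h_cofinal δ hδ _ (hBA _ (hhB ε)).2
    exact ⟨max k l, hk.trans_le ((B.h_mono δ).monotone (le_max_left _ _)),
      hl.trans_le ((A.h_mono δ).monotone (le_max_right _ _))⟩
  choose H' hH'A hH'B using step
  refine ⟨H', fun ε hε hcl' => ?_⟩
  have hmA : ∀ ζ, A.m δ ε ζ ∈ A.cut δ := fun ζ i hi => A.m_lt_c δ i ε ζ hi
  have hmB : ∀ ζ, B.m δ ε ζ ∈ B.cut δ := fun ζ i hi => B.m_lt_c δ i ε ζ hi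
  -- Both chains are coinitial in the same cut of the first order, the second after transport by
  -- `f'`.
  refine omegaBit_eq (u := A.m δ ε) (v := fun ζ => f' (B.m δ ε ζ)) (A.m_anti δ ε)
    (fun ζ ξ hζ => e.mono' _ (hBA _ (hmB _)).1 _ (hBA _ (hmB _)).1 (B.m_anti δ ε hζ)) ?_ ?_
  · intro ζ
    refine A.m_coinitial δ ε hε _ fun ε' hε' => ?_
    refine e.symm.lt_apply (hBA _ (hmB ζ)).1 (hAB _ (hhA ε')).1 ?_
    exact (hH'A ε').trans (B.h_lt_m δ _ ε ζ (hcl' ε' hε'))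
  · intro ξ
    obtain ⟨ζ, hζ⟩ := B.m_coinitial δ ε hε (f (A.m δ ε ξ)) fun ε' hε' =>
      e.lt_apply (hAB _ (hmA ξ)).1 (hBA _ (hhB ε')).1
        ((hH'B ε').trans (A.h_lt_m δ _ ε ξ (hcl' ε' hε')))
    exact ⟨ζ, e.symm.apply_lt (hBA _ (hmB ζ)).1 (hAB _ (hmA ξ)).1 hζ⟩

end

/-! ### Independent functions, forcing modulo a maximal filter, countable supports -/

/-- On `ℕ` there is an independent family of functions indexed by any type of size at most
`2 ^ ℵ₀`. -/
theorem exists_independent_family {P : Type} (hP : #P ≤ 𝔠) :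
    ∃ g : P → ℕ → ℕ, ∀ (F : Finset P) (z : P → ℕ), ∃ n, ∀ s ∈ F, g s n = z s := by
  classical
  have hP' : #P ≤ #(ℕ → Bool) := by simpa using hP
  obtain ⟨ι⟩ := hP'
  -- `P` is embedded in the Cantor space. A point of the countable set `Q` is a length `n` and a
  -- table of values on binary words of length `n`; `g s` looks up the word that `s` begins with.
  let Q := Σ n : ℕ, ((Fin n → Bool) → ℕ)
  have : Infinite Q := Infinite.of_injective (fun n : ℕ => (⟨n, fun _ => 0⟩ : Q)) fun m n h =>
    congrArg Sigma.fst h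
  obtain ⟨e⟩ : Nonempty (ℕ ≃ Q) := by
    obtain ⟨h⟩ := nonempty_denumerable Q
    exact ⟨(Denumerable.eqv Q).symm⟩
  refine ⟨fun s n => (e n).2 fun k => ι s k, fun F z => ?_⟩
  have hsep : ∀ p : P × P, ∃ n : ℕ, p.1 ≠ p.2 → ∃ k < n, ι p.1 k ≠ ι p.2 k := by
    intro p
    by_cases h : p.1 = p.2
    · exact ⟨0, fun h' => absurd h h'⟩
    · obtain ⟨k, hk⟩ := Function.ne_iff.1 fun h' => h (ι.injective h')
      exact ⟨k + 1, fun _ => ⟨k, k.lt_succ_self, hk⟩⟩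
  choose N hN using hsep
  let n := (F ×ˢ F).sup N
  have hinj : ∀ s ∈ F, ∀ t ∈ F, (fun k : Fin n => ι s k) = (fun k : Fin n => ι t k) → s = t := by
    intro s hs t ht h
    by_contra hst
    obtain ⟨k, hk, hne⟩ := hN (s, t) hst
    exact hne (congrFun h
      ⟨k, hk.trans_le (Finset.le_sup (f := N) (Finset.mk_mem_product hs ht))⟩)
  let q : Q :=
    ⟨n, fun u => if h : ∃ s ∈ F, (fun k : Fin n => ι s k) = u then z h.choose else 0⟩
  refine ⟨e.symm q, fun s hs => ?_⟩
  have h : ∃ t ∈ F, (fun k : Fin n => ι t k) = fun k : Fin n => ι s k := ⟨s, hs, rfl⟩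
  change (e (e.symm q)).2 _ = z s
  rw [e.apply_symm_apply]
  change dite _ _ _ = _
  rw [dif_pos h, hinj _ h.choose_spec.1 _ hs h.choose_spec.2]

/-- The cylinder of the `n` at which `g` agrees with `z` on `F`. -/
def Cyl {P : Type} (g : P → ℕ → ℕ) (F : Finset P) (z : P → ℕ) : Set ℕ := {n | ∀ s ∈ F, g s n = z s}

/-- A filter that is maximal among those meeting all cylinders of `g`. -/
structure MaxIndependent {P : Type} (g : P → ℕ → ℕ) (D : Filter ℕ) : Prop where
  frequently : ∀ F z, ∃ᶠ n in D, n ∈ Cyl g F z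
  maximal : ∀ A : Set ℕ, (∀ F z, ∃ᶠ n in D, n ∈ Cyl g F z ∧ n ∈ A) → A ∈ D

theorem exists_maxIndependent {P : Type} {g : P → ℕ → ℕ}
    (hg : ∀ (F : Finset P) (z : P → ℕ), ∃ n, ∀ s ∈ F, g s n = z s) :
    ∃ D, MaxIndependent g D := by
  let S : Set (Filter ℕ)ᵒᵈ := {D | ∀ F z, ∃ᶠ n in OrderDual.ofDual D, n ∈ Cyl g F z}
  obtain ⟨D, hD⟩ := zorn_le₀ S (by
    intro C hCS hC
    rcases C.eq_empty_or_nonempty with rfl | ⟨D₀, hD₀⟩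
    · refine ⟨OrderDual.toDual ⊤, fun F z => ?_, by simp⟩
      obtain ⟨n, hn⟩ := hg F z
      exact frequently_top.2 ⟨n, hn⟩
    · refine ⟨OrderDual.toDual (⨅ D : C, OrderDual.ofDual D.1), fun F z => ?_, fun D hD =>
        iInf_le (fun D : C => OrderDual.ofDual D.1) ⟨D, hD⟩⟩
      have : Nonempty C := ⟨⟨D₀, hD₀⟩⟩
      intro hcon
      change _ ∈ ⨅ D : C, OrderDual.ofDual D.1 at hcon
      rw [mem_iInf_of_directed] at hcon
      · obtain ⟨D, hD⟩ := hcon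
        exact hCS D.2 F z hD
      · intro D D'
        rcases hC.total D.2 D'.2 with h | h
        · exact ⟨D', h, le_rfl⟩
        · exact ⟨D, le_rfl, h⟩)
  refine ⟨OrderDual.ofDual D, hD.1, fun A hA => ?_⟩
  have hle : D ≤ OrderDual.toDual (OrderDual.ofDual D ⊓ 𝓟 A) :=
    show OrderDual.ofDual D ⊓ 𝓟 A ≤ OrderDual.ofDual D from inf_le_left
  have hmem : OrderDual.toDual (OrderDual.ofDual D ⊓ 𝓟 A) ∈ S := by
    intro F z
    change ∃ᶠ n in OrderDual.ofDual D ⊓ 𝓟 A, _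
    rw [frequently_inf_principal]
    exact (hA F z).mono fun n hn => hn.symm
  have hge : OrderDual.ofDual D ≤ OrderDual.ofDual D ⊓ 𝓟 A := hD.2 hmem hle
  exact le_principal_iff.1 (hge.trans inf_le_right)

section

variable {P : Type} {g : P → ℕ → ℕ} {D : Filter ℕ}

/-- The condition given by `z` on `F` forces `A`. -/
def Forces (g : P → ℕ → ℕ) (D : Filter ℕ) (F : Finset P) (z : P → ℕ) (A : Set ℕ) : Prop :=
  ∀ᶠ n in D, n ∈ Cyl g F z → n ∈ A

theorem Cyl.anti {F F' : Finset P} {z z' : P → ℕ} (h : F ⊆ F') (hz : ∀ s ∈ F, z' s = z s) :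
    Cyl g F' z' ⊆ Cyl g F z := fun _ hn s hs => (hn s (h hs)).trans (hz s hs)

theorem Forces.mono {F F' : Finset P} {z z' : P → ℕ} {A : Set ℕ} (h : Forces g D F z A)
    (hF : F ⊆ F') (hz : ∀ s ∈ F, z' s = z s) : Forces g D F' z' A :=
  Eventually.mono h fun _ hn hn' => hn (Cyl.anti hF hz hn')

theorem MaxIndependent.frequently_of_forces (hD : MaxIndependent g D) {F F' : Finset P}
    {z : P → ℕ} {A : Set ℕ} (h : Forces g D F z A) : ∃ᶠ n in D, n ∈ Cyl g F' z ∧ n ∈ A := by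
  classical
  refine ((hD.frequently (F ∪ F') z).and_eventually h).mono fun n hn => ?_
  exact ⟨Cyl.anti Finset.subset_union_right (fun _ _ => rfl) hn.1,
    hn.2 (Cyl.anti Finset.subset_union_left (fun _ _ => rfl) hn.1)⟩

/-- The cylinders are dense modulo `D`. -/
theorem MaxIndependent.exists_forces (hD : MaxIndependent g D) (A : Set ℕ) (F : Finset P)
    (z : P → ℕ) : (∃ F' z', F ⊆ F' ∧ (∀ s ∈ F, z' s = z s) ∧ Forces g D F' z' A) ∨
      Forces g D F z Aᶜ := by
  classical
  by_contra! hcon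
  obtain ⟨h1, h2⟩ := hcon
  -- If no extension forces `A`, the complement of `Cyl g F z ∩ A` is positive on every cylinder, so
  -- it belongs to `D` by maximality. Incompatible cylinders are disjoint from `Cyl g F z`;
  -- compatible ones have a common extension that does not force `A`.
  refine h2 (mem_of_superset (hD.maximal (Cyl g F z ∩ A)ᶜ fun F' z' => ?_)
    fun _ hn hn' hA => hn ⟨hn', hA⟩)
  by_cases hc : ∀ s ∈ F, s ∈ F' → z' s = z s
  · let w : P → ℕ := fun s => if s ∈ F' then z' s else z s
    have hwF : ∀ s ∈ F, w s = z s := fun s hs => by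
      by_cases h : s ∈ F'
      · simp only [w, if_pos h]; exact hc s hs h
      · simp only [w, if_neg h]
    have hwF' : ∀ s ∈ F', w s = z' s := fun s hs => by simp only [w, if_pos hs]
    have := h1 (F ∪ F') w Finset.subset_union_left hwF
    refine Frequently.mono (not_eventually.1 this) fun n hn => ?_
    rw [Classical.not_imp] at hn
    exact ⟨Cyl.anti Finset.subset_union_right hwF' hn.1, fun h => hn.2 h.2⟩
  · push Not at hc
    obtain ⟨s, hs, hs', hne⟩ := hc
    exact (hD.frequently F' z').mono fun n hn =>
      ⟨hn, fun h => hne ((hn s hs').symm.trans (h.1 s hs))⟩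

theorem MaxIndependent.exists_forces_of_frequently (hD : MaxIndependent g D) {A : Set ℕ}
    (hA : ∃ᶠ n in D, n ∈ A) : ∃ F z, Forces g D F z A := by
  rcases hD.exists_forces A ∅ 0 with ⟨F, z, -, -, h⟩ | h
  · exact ⟨F, z, h⟩
  · exact absurd (Eventually.mono h fun _ hn => hn (by simp [Cyl])) hA

/-- The condition `z` on `F` decides the value of `f`, or forces it to be nonstandard. -/
def Decides (g : P → ℕ → ℕ) (D : Filter ℕ) (F : Finset P) (z : P → ℕ) (f : ℕ → ℕ∞) : Prop :=
  (∃ m : ℕ, Forces g D F z {n | f n = m}) ∨ ∀ m : ℕ, Forces g D F z {n | f n ≠ m}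

theorem Decides.mono {F F' : Finset P} {z z' : P → ℕ} {f : ℕ → ℕ∞} (h : Decides g D F z f)
    (hF : F ⊆ F') (hz : ∀ s ∈ F, z' s = z s) : Decides g D F' z' f :=
  h.imp (fun ⟨m, hm⟩ => ⟨m, hm.mono hF hz⟩) fun h m => (h m).mono hF hz

/-- `f` is decided on a dense set by conditions with domain in `J`. -/
def Supports (g : P → ℕ → ℕ) (D : Filter ℕ) (J : Set P) (f : ℕ → ℕ∞) : Prop :=
  ∀ (F : Finset P) (z : P → ℕ), ↑F ⊆ J →
    ∃ F' z', F ⊆ F' ∧ ↑F' ⊆ J ∧ (∀ s ∈ F, z' s = z s) ∧ Decides g D F' z' f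

theorem MaxIndependent.exists_decides (hD : MaxIndependent g D) (f : ℕ → ℕ∞) (F : Finset P)
    (z : P → ℕ) : ∃ F' z', F ⊆ F' ∧ (∀ s ∈ F, z' s = z s) ∧ Decides g D F' z' f := by
  by_cases h : ∃ m : ℕ, ∃ F' z', F ⊆ F' ∧ (∀ s ∈ F, z' s = z s) ∧ Forces g D F' z' {n | f n = m}
  · obtain ⟨m, F', z', h1, h2, h3⟩ := h
    exact ⟨F', z', h1, h2, .inl ⟨m, h3⟩⟩
  · push Not at h
    refine ⟨F, z, subset_rfl, fun _ _ => rfl, .inr fun m => ?_⟩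
    rcases hD.exists_forces {n | f n = m} F z with ⟨F', z', h1, h2, h3⟩ | h'
    · exact absurd h3 (h m F' z' h1 h2)
    · exact h'

theorem exists_countable_conditions {J : Set P} (hJ : J.Countable) :
    ∃ C : Set (Finset P × (P → ℕ)), C.Countable ∧
      ∀ (F : Finset P) (z : P → ℕ), ↑F ⊆ J → ∃ z', (F, z') ∈ C ∧ ∀ s ∈ F, z' s = z s := by
  classical
  have := hJ.to_subtype
  let φ : Finset J × (J →₀ ℕ) → Finset P × (P → ℕ) := fun p =>
    (p.1.map (Function.Embedding.subtype _), fun s => if h : s ∈ J then p.2 ⟨s, h⟩ else 0)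
  refine ⟨range φ, countable_range _, fun F z hF => ?_⟩
  let p : Finset J × (J →₀ ℕ) := (F.subtype (· ∈ J), Finsupp.onFinset (F.subtype (· ∈ J))
    (fun s => if s.1 ∈ F then z s else 0) (by simp +contextual))
  refine ⟨(φ p).2, ⟨p, Prod.ext ?_ rfl⟩, fun s hs => ?_⟩
  · exact Finset.subtype_map_of_mem fun x hx => hF hx
  · simp [φ, p, hs, show s ∈ J from hF hs]

/-- A closing-off argument: up to irrelevant values, only countably many conditions live on a
countable set, so adding the domains of deciding extensions keeps it countable; `ω` rounds suffice,
conditions being finite. -/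
theorem MaxIndependent.exists_supports (hD : MaxIndependent g D) (f : ℕ → ℕ∞) :
    ∃ J : Set P, J.Countable ∧ Supports g D J f := by
  classical
  choose E w hE hw hdec using hD.exists_decides f
  have step : ∀ J : Set P, ∃ J' : Set P, J.Countable → J ⊆ J' ∧ J'.Countable ∧
      ∀ (F : Finset P) (z : P → ℕ), ↑F ⊆ J →
        ∃ F' z', F ⊆ F' ∧ ↑F' ⊆ J' ∧ (∀ s ∈ F, z' s = z s) ∧ Decides g D F' z' f := by
    intro J
    by_cases hJ : J.Countable
    · obtain ⟨C, hC, hCJ⟩ := exists_countable_conditions hJ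
      refine ⟨J ∪ ⋃ p ∈ C, ↑(E p.1 p.2), fun _ => ⟨subset_union_left,
        hJ.union (hC.biUnion fun p _ => Finset.countable_toSet _), fun F z hF => ?_⟩⟩
      obtain ⟨z', hz', hzz'⟩ := hCJ F z hF
      refine ⟨E F z', w F z', hE _ _, ?_, fun s hs => (hw _ _ s hs).trans (hzz' s hs), hdec _ _⟩
      exact subset_union_of_subset_right
        (subset_biUnion_of_mem (u := fun p : Finset P × (P → ℕ) => (E p.1 p.2 : Set P)) hz') _
    · exact ⟨J, fun h => absurd h hJ⟩
  choose ext hext using step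
  let K : ℕ → Set P := fun k => ext^[k] ∅
  have hKs : ∀ k, K (k + 1) = ext (K k) := fun k => Function.iterate_succ_apply' _ _ _
  have hK : ∀ k, (K k).Countable := by
    intro k
    induction k with
    | zero => exact countable_empty
    | succ k ih => rw [hKs]; exact (hext _ ih).2.1
  have hmono : Monotone K := monotone_nat_of_le_succ fun k => by
    rw [hKs]; exact (hext _ (hK k)).1
  refine ⟨⋃ k, K k, countable_iUnion hK, fun F z hF => ?_⟩
  obtain ⟨k, hk⟩ : ∃ k, ↑F ⊆ K k := by
    have hd : Directed (· ⊆ ·) K := hmono.directed_le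
    exact hd.exists_mem_subset_of_finset_subset_biUnion hF
  obtain ⟨F', z', h1, h2, h3, h4⟩ := (hext _ (hK k)).2.2 F z hk
  exact ⟨F', z', h1, h2.trans ((hKs k).symm.subset.trans (subset_iUnion K (k + 1))), h3, h4⟩

end

/-! ### Iterated products of a nonprincipal ultrafilter -/

theorem dependsOn_update {P : Type} [DecidableEq P] {F : (P → ℕ) → ℕ∞} {S S' : Set P} {r : P}
    (h : DependsOn F S) (n : ℕ) (hS : ∀ s ∈ S, s ≠ r → s ∈ S') :
    DependsOn (fun z => F (Function.update z r n)) S' := by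
  intro z z' hz
  refine h fun s hs => ?_
  by_cases hsr : s = r
  · subst hsr; simp
  · simp [hsr, hz s (hS s hs hsr)]

theorem apply_update_eq {P : Type} [DecidableEq P] {F : (P → ℕ) → ℕ∞} {S : Set P} {r : P}
    (h : DependsOn F S) (n : ℕ) (hr : r ∉ S) (z : P → ℕ) : F (Function.update z r n) = F z := by
  refine h fun s hs => ?_
  rw [Function.update_of_ne]
  rintro rfl
  exact hr hs

section

variable {P : Type} [LinearOrder P]

/-- Ultrafilters on `P → ℕ` that behave like the product, in increasing order along `R`, of copies
of one nonprincipal ultrafilter. -/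
structure GenericAlong (R : Finset P) (W : Ultrafilter (P → ℕ)) : Prop where
  large : ∀ s ∈ R, ∀ N : ℕ, ∀ᶠ z : P → ℕ in W, N < z s
  mono : ∀ s ∈ R, ∀ t ∈ R, s < t → ∀ᶠ z : P → ℕ in W, z s < z t
  below : ∀ (F : (P → ℕ) → ℕ∞), ∀ b ∈ R, DependsOn F {s | s ∈ R ∧ b < s} →
    (∀ m : ℕ, ∀ᶠ z : P → ℕ in W, (m : ℕ∞) < F z) → ∀ᶠ z : P → ℕ in W, (z b : ℕ∞) < F z
  above : ∀ (F : (P → ℕ) → ℕ∞), ∀ a ∈ R, DependsOn F {s | s ∈ R ∧ s < a} →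
    ∀ᶠ z : P → ℕ in W, F z < z a ∨ F z = ⊤
  avoid : ∀ (F : (P → ℕ) → ℕ∞), ∀ a ∈ R, ∀ b ∈ R, DependsOn F {s | s ∈ R ∧ s ∉ Icc a b} →
    ∀ᶠ z : P → ℕ in W, ¬ ((z a : ℕ∞) ≤ F z ∧ F z ≤ z b)

/-- The coordinates are chosen in increasing order, each generic over the smaller ones. In the
induction the new least coordinate is the outermost: it is a fixed number when the others are
chosen. -/
theorem exists_genericAlong (R : Finset P) : ∃ W, GenericAlong R W := by
  classical
  induction R using Finset.induction_on_min with
  | empty => exact ⟨pure 0, by constructor <;> simp⟩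
  | insert r R hr ih =>
    obtain ⟨W, hW⟩ := ih
    let W' : Ultrafilter (P → ℕ) := (hyperfilter ℕ).bind fun n =>
      W.map fun z => Function.update z r n
    have hW' : ∀ p : (P → ℕ) → Prop, (∀ᶠ n : ℕ in hyperfilter ℕ,
        ∀ᶠ z : P → ℕ in W, p (Function.update z r n)) →
        ∀ᶠ z : P → ℕ in W', p z := fun p h => h
    have hU : ∀ N : ℕ, ∀ᶠ n in (hyperfilter ℕ : Filter ℕ), N < n := fun N => by
      apply hyperfilter_le_cofinite
      rw [Nat.cofinite_eq_atTop]
      exact eventually_gt_atTop N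
    have hne : ∀ s ∈ R, s ≠ r := fun s hs => (hr s hs).ne'
    have hrR : r ∉ R := fun h => lt_irrefl _ (hr r h)
    have hbelow : ∀ (F : (P → ℕ) → ℕ∞) (b : P), b ∈ insert r R →
        DependsOn F {s | s ∈ R ∧ b < s} → (∀ m : ℕ, ∀ᶠ z : P → ℕ in W, (m : ℕ∞) < F z) →
        ∀ᶠ z : P → ℕ in W', (z b : ℕ∞) < F z := by
      intro F b hb hF h
      refine hW' _ (Eventually.of_forall fun n => ?_)
      have heq := apply_update_eq hF n (fun h => hrR h.1)
      rcases Finset.mem_insert.1 hb with rfl | hb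
      · filter_upwards [h n] with z hz
        rw [heq]; simpa using hz
      · filter_upwards [hW.below F b hb hF h] with z hz
        rw [heq]; simpa [hne b hb] using hz
    refine ⟨W', ?_, ?_, ?_, ?_, ?_⟩
    · intro s hs N
      rcases Finset.mem_insert.1 hs with rfl | hs
      · refine hW' _ ((hU N).mono fun n hn => Eventually.of_forall fun z => ?_)
        simpa using hn
      · refine hW' _ (Eventually.of_forall fun n => (hW.large s hs N).mono fun z hz => ?_)
        simpa [hne s hs] using hz
    · intro s hs t ht hst
      refine hW' _ (Eventually.of_forall fun n => ?_)
      rcases Finset.mem_insert.1 hs with rfl | hs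
      · have ht := (Finset.mem_insert.1 ht).resolve_left hst.ne'
        exact (hW.large t ht n).mono fun z hz => by simpa [hne t ht] using hz
      · have ht := (Finset.mem_insert.1 ht).resolve_left ((hr s hs).trans hst).ne'
        exact (hW.mono s hs t ht hst).mono fun z hz => by simpa [hne t ht, hne s hs] using hz
    · intro F b hb hF h
      have hrb : r ≤ b := (Finset.mem_insert.1 hb).elim (fun h => h.ge) fun h => (hr b h).le
      have hF' : DependsOn F {s | s ∈ R ∧ b < s} := fun z z' hz => hF fun s hs =>
        hz s ⟨(Finset.mem_insert.1 hs.1).resolve_left (hrb.trans_lt hs.2).ne', hs.2⟩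
      refine hbelow F b hb hF' fun m => ?_
      obtain ⟨n, hn⟩ := (show ∀ᶠ n : ℕ in hyperfilter ℕ,
          ∀ᶠ z : P → ℕ in W, (m : ℕ∞) < F (Function.update z r n)
        from h m).exists
      exact hn.mono fun z hz => by rwa [apply_update_eq hF' n fun h => hrR h.1] at hz
    · intro F a ha hF
      rcases Finset.mem_insert.1 ha with rfl | ha
      · have hc : ∀ z, F z = F 0 := fun z => hF fun s hs =>
          (hs.2.not_ge ((Finset.mem_insert.1 hs.1).elim (fun h => h.ge) fun h => (hr s h).le)).elim
        induction h : F 0 with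
        | top => exact Eventually.of_forall fun z => .inr ((hc z).trans h)
        | coe m =>
          refine hW' _ ((hU m).mono fun n hn => Eventually.of_forall fun z => .inl ?_)
          rw [hc, h]; simpa using hn
      · refine hW' _ (Eventually.of_forall fun n => ?_)
        refine (hW.above _ a ha (dependsOn_update (r := r) hF n fun s hs hsr => ?_)).mono
          fun z hz => ?_
        · exact ⟨(Finset.mem_insert.1 hs.1).resolve_left hsr, hs.2⟩
        · simpa [hne a ha] using hz
    · intro F a ha' b hb' hF
      rcases Finset.mem_insert.1 ha' with rfl | ha
      · have hF' : DependsOn F {s | s ∈ R ∧ b < s} := fun z z' hz => hF fun s hs => by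
          have hab : a ≤ s := (Finset.mem_insert.1 hs.1).elim (fun h => h.ge) fun h => (hr s h).le
          have hbs : b < s := lt_of_not_ge fun h => hs.2 ⟨hab, h⟩
          have hba : a ≤ b := (Finset.mem_insert.1 hb').elim (fun h => h.ge) fun h => (hr b h).le
          exact hz s ⟨(Finset.mem_insert.1 hs.1).resolve_left (hba.trans_lt hbs).ne', hbs⟩
        -- Here `a` is the new least coordinate, so `F` depends only on coordinates above `b`. It is
        -- either infinite, hence above `z b`, or bounded by a standard `m`, which almost all values
        -- of `z a` exceed.
        by_cases hm : ∀ m : ℕ, ∀ᶠ z : P → ℕ in W, (m : ℕ∞) < F z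
        · exact (hbelow F b hb' hF' hm).mono fun z hz h => hz.not_ge h.2
        · push Not at hm
          obtain ⟨m, hm⟩ := hm
          refine hW' _ ((hU m).mono fun n hn => hm.mono fun z hz h => ?_)
          rw [apply_update_eq hF' n fun h => hrR h.1] at h
          exact absurd (h.1.trans hz) (by simpa using hn)
      · rcases Finset.mem_insert.1 hb' with rfl | hb
        · refine (show ∀ᶠ z : P → ℕ in W', z b < z a from ?_).mono fun z hz h => ?_
          · refine hW' _ (Eventually.of_forall fun n => (hW.large a ha n).mono fun z hz => ?_)
            simpa [hne a ha] using hz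
          · exact (Nat.cast_lt.2 hz).not_ge (h.1.trans h.2)
        · refine hW' _ (Eventually.of_forall fun n => ?_)
          refine (hW.avoid _ a ha b hb (dependsOn_update (r := r) hF n fun s hs hsr => ?_)).mono
            fun z hz => ?_
          · exact ⟨(Finset.mem_insert.1 hs.1).resolve_left hsr, hs.2⟩
          · simpa [hne a ha, hne b hb] using hz

end

/-! ### Generic points and sections of functions -/

/-- Finite partial functions, as total functions with a finite domain of validity. -/
structure Condition (P : Type) where
  dom : Finset P
  val : P → ℕ

instance (P : Type) : Preorder (Condition P) where
  le p q := p.dom ⊆ q.dom ∧ ∀ s ∈ p.dom, q.val s = p.val s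
  le_refl p := ⟨subset_rfl, fun _ _ => rfl⟩
  le_trans p q r h h' :=
    ⟨h.1.trans h'.1, fun s hs => (h'.2 s (h.1 hs)).trans (h.2 s hs)⟩

/-- A point meeting countably many dense sets of conditions. -/
theorem exists_generic {P ι : Type} [Countable ι] (𝒟 : ι → Finset P → (P → ℕ) → Prop)
    (h : ∀ i F (z : P → ℕ), ∃ (F' : Finset P) (z' : P → ℕ), F ⊆ F' ∧
      (∀ s ∈ F, z' s = z s) ∧ 𝒟 i F' z') :
    ∃ y : P → ℕ, ∀ i, ∃ F z, 𝒟 i F z ∧ ∀ s ∈ F, y s = z s := by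
  classical
  have := Encodable.ofCountable ι
  let C : ι → Order.Cofinal (Condition P) := fun i => ⟨{p | 𝒟 i p.dom p.val}, fun p => by
    obtain ⟨F', z', h1, h2, h3⟩ := h i p.dom p.val
    exact ⟨⟨F', z'⟩, h3, h1, h2⟩⟩
  let I := Order.idealOfCofinals ⟨∅, 0⟩ C
  refine ⟨fun s => if hs : ∃ p ∈ I, s ∈ p.dom then hs.choose.val s else 0, fun i => ?_⟩
  obtain ⟨p, hp, hpI⟩ := Order.cofinal_meets_idealOfCofinals ⟨∅, 0⟩ C i
  refine ⟨p.dom, p.val, hp, fun s hs => ?_⟩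
  have hex : ∃ p ∈ I, s ∈ p.dom := ⟨p, hpI, hs⟩
  simp only [dif_pos hex]
  obtain ⟨hq, hsq⟩ := hex.choose_spec
  obtain ⟨r, -, hpr, hqr⟩ := I.directed p hpI _ hq
  exact (hqr.2 s hsq).symm.trans (hpr.2 s hs)

section

variable {P : Type} {g : P → ℕ → ℕ} {D : Filter ℕ}

open Classical in
/-- Some value satisfying `q`, or `⊤` if there is none. -/
noncomputable def someValue (q : ℕ → Prop) : ℕ∞ :=
  if h : ∃ m, q m then (h.choose : ℕ∞) else ⊤

theorem someValue_eq {q : ℕ → Prop} (hq : ∀ m m', q m → q m' → m = m') {m : ℕ} (hm : q m) :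
    someValue q = m := by
  have h : ∃ m, q m := ⟨m, hm⟩
  rw [someValue, dif_pos h, hq _ _ h.choose_spec hm]

theorem someValue_eq_top {q : ℕ → Prop} (hq : ∀ m, ¬ q m) : someValue q = ⊤ :=
  dif_neg fun ⟨m, hm⟩ => hq m hm

theorem of_someValue_eq {q : ℕ → Prop} {m : ℕ} (h : someValue q = m) : q m := by
  rw [someValue] at h
  split_ifs at h with h'
  · exact Nat.cast_injective h ▸ h'.choose_spec
  · exact absurd h.symm (ENat.natCast_ne_top m)

theorem of_someValue_eq_top {q : ℕ → Prop} (h : someValue q = ⊤) (m : ℕ) : ¬ q m := by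
  intro hm
  rw [someValue, dif_pos ⟨m, hm⟩] at h
  exact ENat.natCast_ne_top _ h

/-- The value of `f` decided by the conditions with domain in `J` that are compatible with `z`. -/
noncomputable def decidedValue (g : P → ℕ → ℕ) (D : Filter ℕ) (J : Set P) (f : ℕ → ℕ∞)
    (z : P → ℕ) : ℕ∞ :=
  someValue fun m => ∃ F : Finset P, ↑F ⊆ J ∧ Forces g D F z {n | f n = m}

theorem decidedValue_congr {J : Set P} {f : ℕ → ℕ∞} {z z' : P → ℕ} (h : ∀ s ∈ J, z s = z' s) :
    decidedValue g D J f z = decidedValue g D J f z' := by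
  have : ∀ m : ℕ, (∃ F : Finset P, ↑F ⊆ J ∧ Forces g D F z {n | f n = m}) ↔
      ∃ F : Finset P, ↑F ⊆ J ∧ Forces g D F z' {n | f n = m} := fun m =>
    ⟨fun ⟨F, hF, hf⟩ => ⟨F, hF, hf.mono subset_rfl fun s hs => (h s (hF hs)).symm⟩,
      fun ⟨F, hF, hf⟩ => ⟨F, hF, hf.mono subset_rfl fun s hs => h s (hF hs)⟩⟩
  exact congrArg someValue (funext fun m => propext (this m))

theorem MaxIndependent.decidedValue_eq (hD : MaxIndependent g D) {J : Set P} {f : ℕ → ℕ∞}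
    {F : Finset P} {z : P → ℕ} {m : ℕ} (hF : ↑F ⊆ J) (h : Forces g D F z {n | f n = m}) :
    decidedValue g D J f z = m := by
  refine someValue_eq (fun k k' ⟨E, _, hE⟩ ⟨E', _, hE'⟩ => ?_) ⟨F, hF, h⟩
  obtain ⟨n, ⟨hn, hk⟩, hk'⟩ := ((hD.frequently_of_forces (F' := E') hE).and_eventually hE').exists
  exact Nat.cast_injective (R := ℕ∞) ((show f n = k from hk).symm.trans (hk' hn))

theorem MaxIndependent.decidedValue_eq_top (hD : MaxIndependent g D) {J : Set P} {f : ℕ → ℕ∞}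
    {F : Finset P} {z : P → ℕ} (h : ∀ m : ℕ, Forces g D F z {n | f n ≠ m}) :
    decidedValue g D J f z = ⊤ := by
  refine someValue_eq_top fun m ⟨F', _, hF'⟩ => ?_
  obtain ⟨n, ⟨hn, hn'⟩, hn''⟩ :=
    ((hD.frequently_of_forces (F' := F) hF').and_eventually (h m)).exists
  exact hn'' hn hn'

theorem MaxIndependent.decidedValue_eq_of_decides (hD : MaxIndependent g D) {J : Set P}
    {f : ℕ → ℕ∞} {F : Finset P} {z z' : P → ℕ} (hF : ↑F ⊆ J) (h : Decides g D F z f)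
    (hz : ∀ s ∈ F, z' s = z s) : decidedValue g D J f z' = decidedValue g D J f z := by
  rcases h with ⟨m, hm⟩ | h
  · rw [hD.decidedValue_eq hF hm, hD.decidedValue_eq hF (hm.mono subset_rfl hz)]
  · rw [hD.decidedValue_eq_top h, hD.decidedValue_eq_top fun m => (h m).mono subset_rfl hz]

theorem eventually_lt_of_forall_ne {l : Filter ℕ} {f : ℕ → ℕ∞}
    (h : ∀ m : ℕ, ∀ᶠ n in l, f n ≠ m) (K : ℕ) : ∀ᶠ n in l, (K : ℕ∞) < f n := by
  have := (Finset.eventually_all (Finset.range (K + 1))).2 fun m _ => h m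
  filter_upwards [this] with n hn
  by_contra! hle
  lift f n to ℕ using ne_top_of_le_ne_top (ENat.natCast_ne_top K) hle with v
  exact hn v (Finset.mem_range.2 (Nat.lt_succ_of_le (Nat.cast_le.1 hle))) rfl

theorem MaxIndependent.eventually_agree (hD : MaxIndependent g D) {J : Set P}
    {f : ℕ → ℕ∞} {F : Finset P} {z : P → ℕ} (hF : ↑F ⊆ J) (h : Decides g D F z f) (K : ℕ) :
    ∀ᶠ n in D, n ∈ Cyl g F z → (∀ m : ℕ, decidedValue g D J f z = m → f n = m) ∧
      (decidedValue g D J f z = ⊤ → (K : ℕ∞) < f n) := by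
  rcases h with ⟨m, hm⟩ | h
  · filter_upwards [hm] with n hn hn'
    rw [hD.decidedValue_eq hF hm]
    exact ⟨fun k hk => (hn hn').trans hk, fun h => absurd h (ENat.natCast_ne_top m)⟩
  · rw [hD.decidedValue_eq_top h]
    have := eventually_lt_of_forall_ne (l := D ⊓ 𝓟 (Cyl g F z)) (f := f)
      (fun m => eventually_inf_principal.2 (h m)) K
    filter_upwards [eventually_inf_principal.1 this] with n hn hn'
    exact ⟨fun k hk => absurd hk.symm (ENat.natCast_ne_top k), fun _ => hn hn'⟩

/-- The values of `u` off `T` are generic enough for `f`: conditions on `J ∩ T` extend within `J`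
to conditions deciding `f` that are compatible with `u` off `T`. -/
def GenericOff (g : P → ℕ → ℕ) (D : Filter ℕ) (T J : Set P) (f : ℕ → ℕ∞) (u : P → ℕ) : Prop :=
  ∀ (F₀ : Finset P) (z₀ : P → ℕ), ↑F₀ ⊆ J ∩ T → ∃ F z, F₀ ⊆ F ∧ ↑F ⊆ J ∧ (∀ s ∈ F₀, z s = z₀ s) ∧
    (∀ s ∈ F, s ∉ T → z s = u s) ∧ Decides g D F z f

/-- The values on the finite set `R` are to be chosen after `y`, so `y` must be generic whatever
they are. There are countably many possibilities for them, hence still only countably many dense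
sets. -/
theorem exists_genericOff (T : Set P) (R : Finset P) (Φ : Finset ((ℕ → ℕ∞) × Set P))
    (hc : ∀ p ∈ Φ, p.2.Countable) (hs : ∀ p ∈ Φ, Supports g D p.2 p.1) :
    ∃ y : P → ℕ, ∀ u : P → ℕ, (∀ s ∉ R, u s = y s) → ∀ p ∈ Φ, GenericOff g D T p.2 p.1 u := by
  classical
  have hJ : (⋃ p ∈ Φ, p.2).Countable := Φ.countable_toSet.biUnion hc
  obtain ⟨C, hC, hCJ⟩ := exists_countable_conditions hJ
  have := hC.to_subtype
  let 𝒟 : Φ × (R → ℕ) × C → Finset P → (P → ℕ) → Prop := fun i F y =>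
    ↑i.2.2.1.1 ⊆ i.1.1.2 ∩ T → ∃ F₁ z, i.2.2.1.1 ⊆ F₁ ∧ ↑F₁ ⊆ i.1.1.2 ∧
      (∀ s ∈ i.2.2.1.1, z s = i.2.2.1.2 s) ∧ Decides g D F₁ z i.1.1.1 ∧
      ∀ s ∈ F₁, s ∉ T → (∀ h : s ∈ R, z s = i.2.1 ⟨s, h⟩) ∧ (s ∉ R → s ∈ F ∧ z s = y s)
  obtain ⟨y, hy⟩ := exists_generic 𝒟 (by
    rintro ⟨⟨p, hp⟩, x, ⟨⟨F₀, z₀⟩, -⟩⟩ F y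
    by_cases hF₀ : (F₀ : Set P) ⊆ p.2 ∩ T
    swap
    · exact ⟨F, y, subset_rfl, fun _ _ => rfl, fun h => absurd h hF₀⟩
    -- The condition to be extended follows `z₀` on `T`, the prescribed values `x` on `R` off `T`,
    -- and the generic point under construction elsewhere.
    let z₁ : P → ℕ := fun s => if s ∈ T then z₀ s else if h : s ∈ R then x ⟨s, h⟩ else y s
    obtain ⟨F₁, z, h1, h2, h3, h4⟩ := hs p hp (F₀ ∪ (F ∪ R).filter (· ∈ p.2)) z₁ (by
      intro s hs
      rcases Finset.mem_union.1 hs with h | h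
      · exact (hF₀ h).1
      · exact (Finset.mem_filter.1 h).2)
    refine ⟨F ∪ F₁, fun s => if s ∈ F then y s else z s, Finset.subset_union_left,
      fun s hs => if_pos hs, fun _ => ⟨F₁, z, Finset.subset_union_left.trans h1, h2,
        fun s hs => ?_, h4, fun s hs hsT => ⟨fun h => ?_, fun h => ⟨?_, ?_⟩⟩⟩⟩
    · rw [h3 s (Finset.mem_union_left _ hs)]
      exact if_pos (hF₀ hs).2
    · rw [h3 s (by simp [h, h2 hs])]
      simp [z₁, hsT, h]
    · exact Finset.mem_union_right _ hs
    · by_cases hsF : s ∈ F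
      · simp only [if_pos hsF]
        rw [h3 s (by simp [hsF, h2 hs])]
        simp [z₁, hsT, h]
      · simp only [if_neg hsF])
  refine ⟨y, fun u hu p hp F₀ z₀ hF₀ => ?_⟩
  obtain ⟨z₀', hz₀', hz⟩ := hCJ F₀ z₀ fun s hs =>
    mem_biUnion (show p ∈ (Φ : Set _) from hp) (hF₀ hs).1
  obtain ⟨F, y', h, hyy'⟩ := hy (⟨p, hp⟩, fun s => u s, ⟨(F₀, z₀'), hz₀'⟩)
  obtain ⟨F₁, z, h1, h2, h3, h4, h5⟩ := h hF₀
  refine ⟨F₁, z, h1, h2, fun s hs => (h3 s hs).trans (hz s hs), fun s hs hsT => ?_, h4⟩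
  by_cases hsR : s ∈ R
  · exact (h5 s hs hsT).1 hsR
  · rw [hu s hsR, ((h5 s hs hsT).2 hsR).2, hyy' s ((h5 s hs hsT).2 hsR).1]

open Classical in
/-- The section of `f` at the values `u` off `T`. -/
noncomputable def sectionAt (g : P → ℕ → ℕ) (D : Filter ℕ) (T J : Set P) (f : ℕ → ℕ∞) (u : P → ℕ)
    (n : ℕ) : ℕ∞ :=
  decidedValue g D J f (T.piecewise (fun s => g s n) u)

-- A condition on `J ∩ T` extends to one that decides `f` and agrees with `u` off `T`; its
-- restriction to `T` then decides the section.
open Classical in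
theorem MaxIndependent.supports_sectionAt (hD : MaxIndependent g D) {T J : Set P} {f : ℕ → ℕ∞}
    {u : P → ℕ} (h : GenericOff g D T J f u) : Supports g D (J ∩ T) (sectionAt g D T J f u) := by
  intro F₀ z₀ hF₀
  obtain ⟨F, z, h1, h2, h3, h4, h5⟩ := h F₀ z₀ hF₀
  have hval : ∀ n ∈ Cyl g (F.filter (· ∈ T)) z,
      sectionAt g D T J f u n = decidedValue g D J f z := by
    intro n hn
    refine hD.decidedValue_eq_of_decides h2 h5 fun s hs => ?_
    by_cases hsT : s ∈ T
    · rw [piecewise_eq_of_mem _ _ _ hsT]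
      exact hn s (Finset.mem_filter.2 ⟨hs, hsT⟩)
    · rw [piecewise_eq_of_notMem _ _ _ hsT, h4 s hs hsT]
  refine ⟨F.filter (· ∈ T), z, fun s hs => Finset.mem_filter.2 ⟨h1 hs, (hF₀ hs).2⟩, ?_, h3, ?_⟩
  · intro s hs
    have := Finset.mem_filter.1 hs
    exact ⟨h2 this.1, this.2⟩
  · rcases h5 with ⟨m, hm⟩ | h5
    · exact .inl ⟨m, Eventually.of_forall fun n hn =>
        (hval n hn).trans (hD.decidedValue_eq h2 hm)⟩
    · refine .inr fun m => Eventually.of_forall fun n hn => ?_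
      change _ ≠ _
      rw [hval n hn, hD.decidedValue_eq_top h5]
      exact (ENat.natCast_ne_top m).symm

open Classical in
theorem GenericOff.exists_decides {T : Set P} {u : P → ℕ} (Φ : Finset ((ℕ → ℕ∞) × Set P))
    (h : ∀ p ∈ Φ, GenericOff g D T p.2 p.1 u) (F₀ : Finset P) (z₀ : P → ℕ) (hF₀ : ↑F₀ ⊆ T) :
    ∃ F z, F₀ ⊆ F ∧ ↑F ⊆ T ∧ (∀ s ∈ F₀, z s = z₀ s) ∧ ∀ p ∈ Φ, ∃ E : Finset P, ↑E ⊆ p.2 ∧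
      (∀ s ∈ E, s ∈ T → s ∈ F) ∧ Decides g D E (T.piecewise z u) p.1 := by
  induction Φ using Finset.induction_on with
  | empty => exact ⟨F₀, z₀, subset_rfl, hF₀, fun _ _ => rfl, by simp⟩
  | insert p Φ _ ih =>
    obtain ⟨F, z, h1, h2, h3, h4⟩ := ih fun q hq => h q (Finset.mem_insert_of_mem hq)
    obtain ⟨E, w, e1, e2, e3, e4, e5⟩ :=
      h p (Finset.mem_insert_self _ _) (F.filter (· ∈ p.2)) z fun s hs => by
        have := Finset.mem_filter.1 hs
        exact ⟨this.2, h2 this.1⟩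
    refine ⟨F ∪ E.filter (· ∈ T), fun s => if s ∈ F then z s else w s,
      h1.trans Finset.subset_union_left, ?_, fun s hs => ?_, fun q hq => ?_⟩
    · intro s hs
      rcases Finset.mem_union.1 hs with h | h
      · exact h2 h
      · exact (Finset.mem_filter.1 h).2
    · simp only [if_pos (h1 hs), h3 s hs]
    · rcases Finset.mem_insert.1 hq with rfl | hq
      · refine ⟨E, e2, fun s hs hsT => by simp [hs, hsT], e5.mono subset_rfl fun s hs => ?_⟩
        by_cases hsT : s ∈ T
        · rw [piecewise_eq_of_mem _ _ _ hsT]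
          by_cases hsF : s ∈ F
          · rw [if_pos hsF, e3 s (Finset.mem_filter.2 ⟨hsF, e2 hs⟩)]
          · rw [if_neg hsF]
        · rw [piecewise_eq_of_notMem _ _ _ hsT, e4 s hs hsT]
      · obtain ⟨E', e1', e2', e3'⟩ := h4 q hq
        refine ⟨E', e1', fun s hs hsT => Finset.mem_union_left _ (e2' s hs hsT),
          e3'.mono subset_rfl fun s hs => ?_⟩
        by_cases hsT : s ∈ T
        · rw [piecewise_eq_of_mem _ _ _ hsT, piecewise_eq_of_mem _ _ _ hsT, if_pos (e2' s hs hsT)]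
        · rw [piecewise_eq_of_notMem _ _ _ hsT, piecewise_eq_of_notMem _ _ _ hsT]

end

/-! ### Requirements on an ultrafilter at one stage -/

section

variable {P Ξ : Type} [LinearOrder P] [LinearOrder Ξ]

/-- The elements of stage less than `ξ`. -/
def Below (st : P → Ξ) (ξ : Ξ) : Set P := {s | st s < ξ}

/-- Either `a` and `b` have the same stage, or `b` is alone in its stage. -/
def Linked (st : P → Ξ) (a b : P) : Prop := st a = st b ∨ ∀ r, st r = st b → r = b

/-- The functions `g s`, for `s ∈ T`, are infinite and increasing modulo `V`, and functions with
countable support only separate linked elements with support between them. -/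
structure Cuts (g : P → ℕ → ℕ) (D : Filter ℕ) (st : P → Ξ) (T : Set P) (V : Ultrafilter ℕ) :
    Prop where
  large : ∀ s ∈ T, ∀ N : ℕ, ∀ᶠ n in V, N < g s n
  mono : ∀ s ∈ T, ∀ t ∈ T, s < t → ∀ᶠ n in V, g s n < g t n
  avoid : ∀ (f : ℕ → ℕ∞) (J : Set P), J.Countable → J ⊆ T → Supports g D J f → ∀ a ∈ T, ∀ b ∈ T,
    a < b → Linked st a b → Disjoint J (Icc a b) → ∀ᶠ n in V, ¬ ((g a n : ℕ∞) ≤ f n ∧ f n ≤ g b n)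

/-- Nonstandard functions supported below stage `η` dominate all `g s` of later stages. -/
def Dominates (g : P → ℕ → ℕ) (D : Filter ℕ) (st : P → Ξ) (V : Ultrafilter ℕ) (η : Ξ) : Prop :=
  ∀ (f : ℕ → ℕ∞) (J : Set P), J.Countable → J ⊆ Below st η → Supports g D J f →
    (∀ m : ℕ, ∀ᶠ n in V, f n ≠ m) → ∀ s ∉ Below st η, ∀ᶠ n in V, (g s n : ℕ∞) < f n

/-- `V` and `V'` give the same values to the functions supported below stage `ξ`. -/
def AgreeBelow (g : P → ℕ → ℕ) (D : Filter ℕ) (st : P → Ξ) (ξ : Ξ) (V V' : Ultrafilter ℕ) : Prop :=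
  ∀ (f : ℕ → ℕ∞) (J : Set P), J.Countable → J ⊆ Below st ξ → Supports g D J f →
    ∀ m : ℕ, (∀ᶠ n in V, f n = m) ↔ ∀ᶠ n in V', f n = m

/-- A finite part of the requirements on an ultrafilter extending the values of `V` below stage
`ξ`. -/
structure Requirements (g : P → ℕ → ℕ) (st : P → Ξ) (ξ : Ξ) (V : Ultrafilter ℕ) (R : Finset P)
    (M : ℕ) (Φ : Set ((ℕ → ℕ∞) × Set P)) (n : ℕ) : Prop where
  large : ∀ s ∈ R, M < g s n
  mono : ∀ s ∈ R, ∀ t ∈ R, s < t → g s n < g t n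
  avoid : ∀ p ∈ Φ, ∀ a ∈ R, ∀ b ∈ R, a < b → Linked st a b → Disjoint p.2 (Icc a b) →
    ¬ ((g a n : ℕ∞) ≤ p.1 n ∧ p.1 n ≤ g b n)
  agree : ∀ p ∈ Φ, p.2 ⊆ Below st ξ → ∀ m : ℕ, (∀ᶠ k in V, p.1 k = m) → p.1 n = m
  dominates : ∀ p ∈ Φ, p.2 ⊆ Below st ξ → (∀ m : ℕ, ∀ᶠ k in V, p.1 k ≠ m) → ∀ s ∈ R,
    s ∉ Below st ξ → (g s n : ℕ∞) < p.1 n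

/-- The value of the section of `f` at `u` modulo `V`. -/
noncomputable def sectionValue (g : P → ℕ → ℕ) (D : Filter ℕ) (V : Ultrafilter ℕ) (T J : Set P)
    (f : ℕ → ℕ∞) (u : P → ℕ) : ℕ∞ :=
  someValue fun m => ∀ᶠ n in V, sectionAt g D T J f u n = m

variable {g : P → ℕ → ℕ} {D : Filter ℕ} {st : P → Ξ} {ξ : Ξ} {V : Ultrafilter ℕ}

/-- Values at the elements of `R` off `T` that suit the sections of the members of `Φ`. -/
theorem exists_values (T : Set P) (R : Finset P) (y : P → ℕ)
    (Φ : Finset ((ℕ → ℕ∞) × Set P)) (M : ℕ) :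
    ∃ u : P → ℕ, (∀ s ∉ R, u s = y s) ∧ (∀ s ∈ R, M < u s) ∧
      (∀ s ∈ R, ∀ t ∈ R, s < t → u s < u t) ∧
      (∀ p ∈ Φ, ∀ a ∈ R, ∀ b ∈ R, Disjoint p.2 (Icc a b) →
        ¬ ((u a : ℕ∞) ≤ sectionValue g D V T p.2 p.1 u ∧
          sectionValue g D V T p.2 p.1 u ≤ u b)) ∧
      ∀ p ∈ Φ, ∀ a ∈ R, (∀ s ∈ R, s ∈ p.2 → s < a) →
        sectionValue g D V T p.2 p.1 u < u a ∨ sectionValue g D V T p.2 p.1 u = ⊤ := by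
  classical
  obtain ⟨W, hW⟩ := exists_genericAlong R
  let e : (P → ℕ) → P → ℕ := fun x => (R : Set P).piecewise x y
  have he : ∀ x, ∀ s ∈ R, e x s = x s := fun x s hs => piecewise_eq_of_mem _ _ _ hs
  have hdep : ∀ (p : (ℕ → ℕ∞) × Set P) (S : Set P), (∀ s ∈ R, s ∈ p.2 → s ∈ S) →
      DependsOn (fun x => sectionValue g D V T p.2 p.1 (e x)) S := by
    intro p S hS x x' hx
    have : sectionAt g D T p.2 p.1 (e x) = sectionAt g D T p.2 p.1 (e x') := by
      funext n
      refine decidedValue_congr fun s hs => ?_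
      by_cases hsT : s ∈ T
      · simp [hsT]
      · by_cases hsR : s ∈ R
        · simp [e, hsT, hsR, hx s (hS s hsR hs)]
        · simp [e, hsT, hsR]
    simp only [sectionValue, this]
  have h1 : ∀ᶠ x : P → ℕ in W, ∀ s ∈ R, M < x s :=
    (Finset.eventually_all R).2 fun s hs => hW.large s hs M
  have h2 : ∀ᶠ x : P → ℕ in W, ∀ s ∈ R, ∀ t ∈ R, s < t → x s < x t :=
    (Finset.eventually_all R).2 fun s hs => (Finset.eventually_all R).2 fun t ht =>
      eventually_imp_distrib_left.2 fun h => hW.mono s hs t ht h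
  have h3 : ∀ᶠ x : P → ℕ in W, ∀ p ∈ Φ, ∀ a ∈ R, ∀ b ∈ R, Disjoint p.2 (Icc a b) →
      ¬ ((x a : ℕ∞) ≤ sectionValue g D V T p.2 p.1 (e x) ∧
        sectionValue g D V T p.2 p.1 (e x) ≤ x b) :=
    (Finset.eventually_all Φ).2 fun p _ => (Finset.eventually_all R).2 fun a ha =>
      (Finset.eventually_all R).2 fun b hb => eventually_imp_distrib_left.2 fun h =>
        hW.avoid _ a ha b hb (hdep p _ fun s hs hsp => ⟨hs, fun hs' =>
          disjoint_left.1 h hsp hs'⟩)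
  have h4 : ∀ᶠ x : P → ℕ in W, ∀ p ∈ Φ, ∀ a ∈ R, (∀ s ∈ R, s ∈ p.2 → s < a) →
      sectionValue g D V T p.2 p.1 (e x) < x a ∨ sectionValue g D V T p.2 p.1 (e x) = ⊤ :=
    (Finset.eventually_all Φ).2 fun p _ => (Finset.eventually_all R).2 fun a ha =>
      eventually_imp_distrib_left.2 fun h =>
        hW.above _ a ha (hdep p _ fun s hs hsp => ⟨hs, h s hs hsp⟩)
  obtain ⟨x, h1, h2, h3, h4⟩ := (h1.and (h2.and (h3.and h4))).exists
  refine ⟨e x, fun s hs => piecewise_eq_of_notMem _ _ _ hs, fun s hs => ?_, fun s hs t ht => ?_,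
    fun p hp a ha b hb => ?_, fun p hp a ha => ?_⟩
  · rw [he x s hs]; exact h1 s hs
  · rw [he x s hs, he x t ht]; exact h2 s hs t ht
  · rw [he x a ha, he x b hb]; exact h3 p hp a ha b hb
  · rw [he x a ha]; exact h4 p hp a ha

end

section

variable {P Ξ : Type} [LinearOrder P] [LinearOrder Ξ]
variable {g : P → ℕ → ℕ} {D : Filter ℕ} {st : P → Ξ} {ξ : Ξ} {V : Ultrafilter ℕ}

/-- What `V` knows about the sections at `u`, for the parameters `R`, `M`, `Φ` and bounds `B` of the
values of `u`. -/
structure SectionFacts (g : P → ℕ → ℕ) (D : Filter ℕ) (st : P → Ξ) (ξ : Ξ) (V : Ultrafilter ℕ)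
    (R : Finset P) (M B : ℕ) (Φ : Finset ((ℕ → ℕ∞) × Set P)) (u : P → ℕ) (n : ℕ) : Prop where
  large : ∀ s ∈ R, s ∈ Below st ξ → max M B < g s n
  mono : ∀ s ∈ R, ∀ t ∈ R, s ∈ Below st ξ → t ∈ Below st ξ → s < t → g s n < g t n
  value : ∀ p ∈ Φ, ∀ m : ℕ, sectionValue g D V (Below st ξ) p.2 p.1 u = m →
    sectionAt g D (Below st ξ) p.2 p.1 u n = m
  value_top : ∀ p ∈ Φ, sectionValue g D V (Below st ξ) p.2 p.1 u = ⊤ →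
    (B : ℕ∞) < sectionAt g D (Below st ξ) p.2 p.1 u n
  avoid : ∀ p ∈ Φ, ∀ a ∈ R, ∀ b ∈ R, a ∈ Below st ξ → b ∈ Below st ξ → a < b → Linked st a b →
    Disjoint p.2 (Icc a b) → ¬ ((g a n : ℕ∞) ≤ sectionAt g D (Below st ξ) p.2 p.1 u n ∧
      sectionAt g D (Below st ξ) p.2 p.1 u n ≤ g b n)
  above : ∀ p ∈ Φ, ∀ a ∈ R, ∀ b ∈ R, a ∉ Below st ξ → b ∈ Below st ξ → a < b → Linked st a b →
    Disjoint p.2 (Icc a b) → sectionValue g D V (Below st ξ) p.2 p.1 u = ⊤ →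
      (g b n : ℕ∞) < sectionAt g D (Below st ξ) p.2 p.1 u n
  agree : ∀ p ∈ Φ, ∀ m : ℕ, (∀ᶠ k in V, p.1 k = m) → p.1 n = m
  infinite : ∀ p ∈ Φ, (∀ m : ℕ, ∀ᶠ k in V, p.1 k ≠ m) → (B : ℕ∞) < p.1 n

theorem below_isUpperSet (hst : Antitone st) : IsUpperSet (Below st ξ) :=
  fun _ _ h (ha : _ < ξ) => (hst h).trans_lt ha

/-- Sections at `u` are supported below stage `ξ`, so all that is known about `V` applies to them.
-/
theorem eventually_sectionFacts (hst : Antitone st) (hD : MaxIndependent g D)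
    (hcut : Cuts g D st (Below st ξ) V) (hdom : ∀ η < ξ, Dominates g D st V η) (R : Finset P)
    (M B : ℕ) (Φ : Finset ((ℕ → ℕ∞) × Set P)) (hc : ∀ p ∈ Φ, p.2.Countable) (u : P → ℕ)
    (hu : ∀ p ∈ Φ, GenericOff g D (Below st ξ) p.2 p.1 u) :
    ∀ᶠ n in V, SectionFacts g D st ξ V R M B Φ u n := by
  have hsupp := fun p hp => hD.supports_sectionAt (hu p hp)
  have hcount : ∀ p ∈ Φ, (p.2 ∩ Below st ξ).Countable := fun p hp =>
    (hc p hp).mono inter_subset_left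
  have htop : ∀ p : (ℕ → ℕ∞) × Set P, sectionValue g D V (Below st ξ) p.2 p.1 u = ⊤ →
      ∀ m : ℕ, ∀ᶠ n in V, sectionAt g D (Below st ξ) p.2 p.1 u n ≠ m := fun p h m =>
    Ultrafilter.eventually_not.2 (of_someValue_eq_top h m)
  have h1 : ∀ᶠ n in V, ∀ s ∈ R, s ∈ Below st ξ → max M B < g s n :=
    (Finset.eventually_all R).2 fun s _ => eventually_imp_distrib_left.2 fun h =>
      hcut.large s h _
  have h2 : ∀ᶠ n in V, ∀ s ∈ R, ∀ t ∈ R, s ∈ Below st ξ → t ∈ Below st ξ → s < t →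
      g s n < g t n :=
    (Finset.eventually_all R).2 fun s _ => (Finset.eventually_all R).2 fun t _ =>
      eventually_imp_distrib_left.2 fun h => eventually_imp_distrib_left.2 fun h' =>
        eventually_imp_distrib_left.2 fun hlt => hcut.mono s h t h' hlt
  have h3 : ∀ᶠ n in V, ∀ p ∈ Φ, ∀ m : ℕ, sectionValue g D V (Below st ξ) p.2 p.1 u = m →
      sectionAt g D (Below st ξ) p.2 p.1 u n = m := by
    refine (Finset.eventually_all Φ).2 fun p _ => ?_
    by_cases h : ∃ m : ℕ, sectionValue g D V (Below st ξ) p.2 p.1 u = m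
    · obtain ⟨m, hm⟩ := h
      filter_upwards [of_someValue_eq hm] with n hn k hk
      rw [hn, ← hk, hm]
    · exact Eventually.of_forall fun n m hm => absurd ⟨m, hm⟩ h
  have h4 : ∀ᶠ n in V, ∀ p ∈ Φ, sectionValue g D V (Below st ξ) p.2 p.1 u = ⊤ →
      (B : ℕ∞) < sectionAt g D (Below st ξ) p.2 p.1 u n :=
    (Finset.eventually_all Φ).2 fun p _ => eventually_imp_distrib_left.2 fun h =>
      eventually_lt_of_forall_ne (htop p h) B
  have h5 : ∀ᶠ n in V, ∀ p ∈ Φ, ∀ a ∈ R, ∀ b ∈ R, a ∈ Below st ξ → b ∈ Below st ξ → a < b →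
      Linked st a b → Disjoint p.2 (Icc a b) →
        ¬ ((g a n : ℕ∞) ≤ sectionAt g D (Below st ξ) p.2 p.1 u n ∧
          sectionAt g D (Below st ξ) p.2 p.1 u n ≤ g b n) :=
    (Finset.eventually_all Φ).2 fun p hp => (Finset.eventually_all R).2 fun a _ =>
      (Finset.eventually_all R).2 fun b _ => eventually_imp_distrib_left.2 fun ha =>
        eventually_imp_distrib_left.2 fun hb => eventually_imp_distrib_left.2 fun hab =>
          eventually_imp_distrib_left.2 fun hl => eventually_imp_distrib_left.2 fun hd =>
            hcut.avoid _ _ (hcount p hp) inter_subset_right (hsupp p hp) a ha b hb hab hl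
              (hd.mono_left inter_subset_left)
  have h6 : ∀ᶠ n in V, ∀ p ∈ Φ, ∀ a ∈ R, ∀ b ∈ R, a ∉ Below st ξ → b ∈ Below st ξ → a < b →
      Linked st a b → Disjoint p.2 (Icc a b) →
        sectionValue g D V (Below st ξ) p.2 p.1 u = ⊤ →
          (g b n : ℕ∞) < sectionAt g D (Below st ξ) p.2 p.1 u n := by
    refine (Finset.eventually_all Φ).2 fun p hp => (Finset.eventually_all R).2 fun a _ =>
      (Finset.eventually_all R).2 fun b _ => eventually_imp_distrib_left.2 fun ha =>
        eventually_imp_distrib_left.2 fun hb => eventually_imp_distrib_left.2 fun hab =>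
          eventually_imp_distrib_left.2 fun hl => eventually_imp_distrib_left.2 fun hd =>
            eventually_imp_distrib_left.2 fun ht => ?_
    -- Since `a` and `b` have different stages, `b` is alone in its stage. The support of the
    -- section lies above `a` and misses `[a, b]`, so it lies above `b` and in strictly earlier
    -- stages: domination at stage `st b` applies.
    refine hdom (st b) hb _ _ (hcount p hp) ?_ (hsupp p hp) (htop p ht) b (lt_irrefl _)
    rintro r ⟨hrp, hr⟩
    have har : a < r := lt_of_not_ge fun h => ha (below_isUpperSet hst h hr)
    have hbr : b < r := lt_of_not_ge fun h => disjoint_left.1 hd hrp ⟨har.le, h⟩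
    refine (hst hbr.le).lt_of_ne fun heq => ?_
    rcases hl with hl | hl
    · exact ha (show st a < ξ from hl ▸ hb)
    · exact hbr.ne' (hl r heq)
  have h7 : ∀ᶠ n in V, ∀ p ∈ Φ, ∀ m : ℕ, (∀ᶠ k in V, p.1 k = m) → p.1 n = m := by
    refine (Finset.eventually_all Φ).2 fun p _ => ?_
    by_cases h : ∃ m : ℕ, ∀ᶠ k in V, p.1 k = m
    · obtain ⟨m, hm⟩ := h
      filter_upwards [hm] with n hn k hk
      obtain ⟨j, hj, hj'⟩ := (hm.and hk).exists
      rw [hn, ← hj, hj']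
    · exact Eventually.of_forall fun n m hm => absurd ⟨m, hm⟩ h
  have h8 : ∀ᶠ n in V, ∀ p ∈ Φ, (∀ m : ℕ, ∀ᶠ k in V, p.1 k ≠ m) → (B : ℕ∞) < p.1 n :=
    (Finset.eventually_all Φ).2 fun p _ => eventually_imp_distrib_left.2 fun h =>
      eventually_lt_of_forall_ne h B
  filter_upwards [h1, h2, h3, h4, h5, h6, h7, h8] with n h1 h2 h3 h4 h5 h6 h7 h8
  exact ⟨h1, h2, h3, h4, h5, h6, h7, h8⟩

open Classical in
/-- Finitely many requirements can be met on a `D`-positive set. -/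
theorem frequently_requirements (hst : Antitone st) (hD : MaxIndependent g D) (hV : ↑V ≤ D)
    (hcut : Cuts g D st (Below st ξ) V) (hdom : ∀ η < ξ, Dominates g D st V η) (R : Finset P)
    (M : ℕ) (Φ : Finset ((ℕ → ℕ∞) × Set P)) (hc : ∀ p ∈ Φ, p.2.Countable)
    (hs : ∀ p ∈ Φ, Supports g D p.2 p.1) : ∃ᶠ n in D, Requirements g st ξ V R M ↑Φ n := by
  let T := Below st ξ
  let R₁ := R.filter (· ∉ T)
  obtain ⟨y, hy⟩ := exists_genericOff (g := g) (D := D) T R₁ Φ hc hs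
  obtain ⟨u, hu, hM, hmono, havoid, habove⟩ := exists_values (g := g) (D := D) (V := V) T R₁ y Φ M
  have hgen := hy u hu
  let B := R₁.sup u
  have hB : ∀ s ∈ R₁, u s ≤ B := fun s hs => Finset.le_sup hs
  -- What holds `V`-almost everywhere is `D`-positive, hence forced by some condition. The plan: a
  -- point `k` realizes the facts on the side of `T`, and a point `n` of a further cylinder copies
  -- `g s k` for `s ∈ R ∩ T`, but takes the values `u` on the rest of `R`.
  obtain ⟨F₁, z₁, hF₁⟩ := hD.exists_forces_of_frequently
    (A := {n | SectionFacts g D st ξ V R M B Φ u n})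
    fun h => ((eventually_sectionFacts hst hD hcut hdom R M B Φ hc u hgen).and (hV h)).exists.elim
      fun n hn => hn.2 hn.1
  obtain ⟨F, z, hF1, hF2, hF3, hF4⟩ := GenericOff.exists_decides Φ hgen ((F₁ ∪ R).filter (· ∈ T)) z₁
    fun s hs => (Finset.mem_filter.1 hs).2
  choose! E hEJ hEF hEdec using hF4
  have hzF : ∀ s ∈ F₁, (if s ∈ F then z s else z₁ s) = z₁ s := by
    intro s hs
    split_ifs with h
    · exact hF3 s (by simp [hs, show s ∈ T from hF2 h])
    · rfl
  have hfr := hD.frequently_of_forces (F' := F)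
    (hF₁.mono (z' := fun s => if s ∈ F then z s else z₁ s) subset_rfl hzF)
  have hag : ∀ K : ℕ, ∀ᶠ n in D, ∀ p ∈ Φ, n ∈ Cyl g (E p) (T.piecewise z u) →
      (∀ m : ℕ, decidedValue g D p.2 p.1 (T.piecewise z u) = m → p.1 n = m) ∧
        (decidedValue g D p.2 p.1 (T.piecewise z u) = ⊤ → (K : ℕ∞) < p.1 n) := fun K =>
    (Finset.eventually_all Φ).2 fun p hp => hD.eventually_agree (hEJ p hp) (hEdec p hp) K
  -- A bound for the standard values modulo `V`: a function with such a value cannot be above `N` at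
  -- `k`, which excludes the section value `⊤` when agreement is verified.
  let N := Φ.sup fun p => (someValue fun m => ∀ᶠ k in V, p.1 k = m).toNat
  obtain ⟨k, ⟨hkF, hk⟩, hkag⟩ := (hfr.and_eventually (hag N)).exists
  replace hk : SectionFacts g D st ξ V R M B Φ u k := hk
  have hkz : ∀ s ∈ F, g s k = z s := fun s hs => (hkF s hs).trans (if_pos hs)
  have hsec : ∀ p ∈ Φ, sectionAt g D T p.2 p.1 u k =
      decidedValue g D p.2 p.1 (T.piecewise z u) := by
    intro p hp
    refine hD.decidedValue_eq_of_decides (hEJ p hp) (hEdec p hp) fun s hs => ?_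
    by_cases hsT : s ∈ T
    · simp [hsT, hkz s (hEF p hp s hs hsT)]
    · simp [hsT]
  -- Functions whose section is `⊤` at `k` are made larger at `n` than all values of `g` that they
  -- are compared with.
  let K := max B (R.sup fun s => g s k)
  refine ((hD.frequently (F ∪ R₁ ∪ Φ.biUnion E) (T.piecewise z u)).and_eventually (hag K)).mono ?_
  rintro n ⟨hn, hnag⟩
  have hnT : ∀ s ∈ R, s ∈ T → g s n = g s k := by
    intro s hs hsT
    have hsF : s ∈ F := hF1 (by simp [hs, hsT])
    rw [hn s (by simp [hsF]), piecewise_eq_of_mem _ _ _ hsT, hkz s hsF]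
  have hnR : ∀ s ∈ R, s ∉ T → g s n = u s := by
    intro s hs hsT
    rw [hn s (by simp [R₁, hs, hsT]), piecewise_eq_of_notMem _ _ _ hsT]
  have hR₁ : ∀ s ∈ R, s ∉ T → s ∈ R₁ := fun s hs hsT => by simp [R₁, hs, hsT]
  have hval : ∀ p ∈ Φ, (∀ m : ℕ, sectionAt g D T p.2 p.1 u k = m → p.1 n = m) ∧
      (sectionAt g D T p.2 p.1 u k = ⊤ → (K : ℕ∞) < p.1 n) := by
    intro p hp
    rw [hsec p hp]
    exact hnag p hp fun s hs => hn s
      (Finset.mem_union_right _ (Finset.mem_biUnion.2 ⟨p, hp, hs⟩))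
  have hgK : ∀ s ∈ R, g s k ≤ K := fun s hs =>
    (Finset.le_sup (f := fun s => g s k) hs).trans (le_max_right _ _)
  have hlt : ∀ p ∈ Φ, ∀ c : ℕ, c ≤ K → (c : ℕ∞) < sectionAt g D T p.2 p.1 u k →
      (c : ℕ∞) < p.1 n := by
    intro p hp c hc hlt
    induction hv : sectionAt g D T p.2 p.1 u k with
    | top => exact (Nat.cast_le.2 hc).trans_lt ((hval p hp).2 hv)
    | coe m => rw [(hval p hp).1 m hv, ← hv]; exact hlt
  have hBK : B ≤ K := le_max_left _ _
  have hself : ∀ p ∈ Φ, p.2 ⊆ T → (∀ m : ℕ, sectionAt g D T p.2 p.1 u k = m → p.1 k = m) ∧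
      (sectionAt g D T p.2 p.1 u k = ⊤ → (N : ℕ∞) < p.1 k) := by
    intro p hp hpT
    rw [hsec p hp]
    refine hkag p hp fun s hs => ?_
    have hsT := hpT (hEJ p hp hs)
    rw [piecewise_eq_of_mem _ _ _ hsT]
    exact hkz s (hEF p hp s hs hsT)
  have hup : ∀ s t, s < t → s ∈ T → t ∈ T := fun s t h hs => below_isUpperSet hst h.le hs
  refine ⟨fun s hs => ?_, fun s hs t ht hst => ?_, fun p hp a ha b hb hab hl hd => ?_,
    fun p hp hpT m hm => ?_, fun p hp hpT hinf s hs hsT => ?_⟩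
  · by_cases hsT : s ∈ T
    · rw [hnT s hs hsT]
      exact (le_max_left _ _).trans_lt (hk.large s hs hsT)
    · rw [hnR s hs hsT]
      exact hM s (hR₁ s hs hsT)
  · by_cases hsT : s ∈ T
    · have htT := hup s t hst hsT
      rw [hnT s hs hsT, hnT t ht htT]
      exact hk.mono s hs t ht hsT htT hst
    · by_cases htT : t ∈ T
      · rw [hnR s hs hsT, hnT t ht htT]
        exact ((hB s (hR₁ s hs hsT)).trans (le_max_right _ _)).trans_lt (hk.large t ht htT)
      · rw [hnR s hs hsT, hnR t ht htT]
        exact hmono s (hR₁ s hs hsT) t (hR₁ t ht htT) hst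
  · rintro ⟨h1, h2⟩
    by_cases haT : a ∈ T
    · have hbT := hup a b hab haT
      rw [hnT a ha haT] at h1
      rw [hnT b hb hbT] at h2
      refine hk.avoid p hp a ha b hb haT hbT hab hl hd ?_
      change (g a k : ℕ∞) ≤ sectionAt g D T p.2 p.1 u k ∧ sectionAt g D T p.2 p.1 u k ≤ g b k
      induction hv : sectionAt g D T p.2 p.1 u k with
      | top =>
        exact absurd (h2.trans (Nat.cast_le.2 (hgK b hb))) ((hval p hp).2 hv).not_ge
      | coe m => rw [← (hval p hp).1 m hv]; exact ⟨h1, h2⟩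
    · rw [hnR a ha haT] at h1
      have haR := hR₁ a ha haT
      by_cases hbT : b ∈ T
      · rw [hnT b hb hbT] at h2
        have hsa : ∀ s ∈ R₁, s ∈ p.2 → s < a := by
          intro s hs hsp
          by_contra! has
          exact disjoint_left.1 hd hsp ⟨has, le_of_not_gt fun hbs =>
            (Finset.mem_filter.1 hs).2 (hup b s hbs hbT)⟩
        -- The mixed case, `a` off `T` and `b` in `T`. The section value is finite and below `u a`,
        -- or it is `⊤`, and then the section at `k` is above `g b k`.
        rcases habove p hp a haR hsa with h | h
        · induction hF : sectionValue g D V T p.2 p.1 u with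
          | top => exact absurd (hF ▸ h) not_top_lt
          | coe m =>
            rw [(hval p hp).1 m (hk.value p hp m hF), ← hF] at h1
            exact h.not_ge h1
        · exact h2.not_gt (hlt p hp _ (hgK b hb)
            (hk.above p hp a ha b hb haT hbT hab hl hd h))
      · rw [hnR b hb hbT] at h2
        have hbR := hR₁ b hb hbT
        induction hF : sectionValue g D V T p.2 p.1 u with
        | top =>
          exact ((Nat.cast_le.2 (hB b hbR)).trans_lt
            (hlt p hp B hBK (hk.value_top p hp hF))).not_ge h2
        | coe m =>
          rw [(hval p hp).1 m (hk.value p hp m hF), ← hF] at h1 h2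
          exact havoid p hp a haR b hbR hd ⟨h1, h2⟩
  · have hkm := hk.agree p hp m hm
    induction hv : sectionAt g D T p.2 p.1 u k with
    | top =>
      have hmN : m ≤ N := by
        have h : (someValue fun m => ∀ᶠ k in V, p.1 k = m) = m :=
          someValue_eq (fun i j hi hj => by
            obtain ⟨l, hl, hl'⟩ := (hi.and hj).exists
            exact Nat.cast_injective (R := ℕ∞) (hl.symm.trans hl')) hm
        have := Finset.le_sup (f := fun p : (ℕ → ℕ∞) × Set P =>
          (someValue fun m => ∀ᶠ k in V, p.1 k = m).toNat) hp
        simpa [h] using this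
      have := (hself p hp hpT).2 hv
      rw [hkm] at this
      exact absurd hmN (Nat.cast_lt.1 this).not_ge
    | coe i =>
      rw [(hval p hp).1 i hv, ← (hself p hp hpT).1 i hv, hkm]
  · have hBk := hk.infinite p hp hinf
    have hsB : (g s n : ℕ∞) ≤ B := by
      rw [hnR s hs hsT]
      exact Nat.cast_le.2 (hB s (hR₁ s hs hsT))
    refine hsB.trans_lt ?_
    induction hv : sectionAt g D T p.2 p.1 u k with
    | top => exact (Nat.cast_le.2 hBK).trans_lt ((hval p hp).2 hv)
    | coe i => rwa [(hval p hp).1 i hv, ← (hself p hp hpT).1 i hv]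

end

/-! ### Extension by one stage and transfinite construction -/

section

variable {P Ξ : Type} [LinearOrder Ξ] {g : P → ℕ → ℕ} {D : Filter ℕ} {st : P → Ξ}
  {ξ η : Ξ} {V V' : Ultrafilter ℕ}

theorem Supports.indicator_eq {J : Set P} {f : ℕ → ℕ∞} (h : Supports g D J f) (m : ℕ) :
    Supports g D J ({n | f n = m}.indicator 1) := by
  classical
  intro F z hF
  obtain ⟨F', z', h1, h2, h3, h4⟩ := h F z hF
  refine ⟨F', z', h1, h2, h3, .inl ?_⟩
  rcases h4 with ⟨k, hk⟩ | h4
  · by_cases hkm : k = m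
    · refine ⟨1, Eventually.mono hk fun n hn hn' => ?_⟩
      have : f n = k := hn hn'
      simp [indicator_apply, this, hkm]
    · refine ⟨0, Eventually.mono hk fun n hn hn' => ?_⟩
      have : f n = k := hn hn'
      simp [indicator_apply, this, hkm]
  · refine ⟨0, Eventually.mono (h4 m) fun n hn hn' => ?_⟩
    have : f n ≠ m := hn hn'
    simp [indicator_apply, this]

theorem Supports.indicator_lt {J : Set P} {f : ℕ → ℕ∞} (h : Supports g D J f) (s : P) :
    Supports g D (insert s J) ({n | (g s n : ℕ∞) < f n}.indicator 1) := by
  classical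
  intro F z hF
  obtain ⟨F', z', h1, h2, h3, h4⟩ := h (F.filter (· ∈ J)) z fun r hr => (Finset.mem_filter.1 hr).2
  let w : P → ℕ := fun r => if r ∈ F then z r else z' r
  have hw : ∀ r ∈ F', w r = z' r := by
    intro r hr
    by_cases hrF : r ∈ F
    · simp only [w, if_pos hrF]
      exact (h3 r (Finset.mem_filter.2 ⟨hrF, h2 hr⟩)).symm
    · simp only [w, if_neg hrF]
  refine ⟨insert s (F ∪ F'), w, fun r hr => by simp [hr], ?_, fun r hr => if_pos hr, .inl ?_⟩
  · intro r hr
    rcases Finset.mem_insert.1 hr with rfl | hr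
    · exact mem_insert _ _
    · rcases Finset.mem_union.1 hr with hr | hr
      · exact hF hr
      · exact mem_insert_of_mem _ (h2 hr)
  have hsub : F' ⊆ insert s (F ∪ F') := fun r hr => by simp [hr]
  rcases h4 with ⟨k, hk⟩ | h4
  · replace hk := hk.mono hsub hw
    by_cases hlt : w s < k
    · refine ⟨1, Eventually.mono hk fun n hn hn' => ?_⟩
      have h1 : f n = k := hn hn'
      have h2 : g s n = w s := hn' s (Finset.mem_insert_self _ _)
      simp [indicator_apply, h1, h2, hlt]
    · refine ⟨0, Eventually.mono hk fun n hn hn' => ?_⟩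
      have h1 : f n = k := hn hn'
      have h2 : g s n = w s := hn' s (Finset.mem_insert_self _ _)
      simp [indicator_apply, h1, h2, not_lt.1 hlt]
  · refine ⟨1, ?_⟩
    have := eventually_lt_of_forall_ne (l := D ⊓ 𝓟 (Cyl g (insert s (F ∪ F')) w)) (f := f)
      (fun m => eventually_inf_principal.2 ((h4 m).mono hsub hw)) (w s)
    refine Eventually.mono (eventually_inf_principal.1 this) fun n hn hn' => ?_
    have h2 : g s n = w s := hn' s (Finset.mem_insert_self _ _)
    simp [indicator_apply, h2, hn hn']

theorem AgreeBelow.mono (h : AgreeBelow g D st ξ V V') (hη : η ≤ ξ) : AgreeBelow g D st η V V' :=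
  fun f J hJ hJη => h f J hJ (hJη.trans fun _ (hs : _ < η) => hs.trans_le hη)

theorem AgreeBelow.trans {V'' : Ultrafilter ℕ} (h : AgreeBelow g D st ξ V V')
    (h' : AgreeBelow g D st ξ V' V'') : AgreeBelow g D st ξ V V'' :=
  fun f J hJ hJξ hf m => (h f J hJ hJξ hf m).trans (h' f J hJ hJξ hf m)

theorem AgreeBelow.ne_iff (h : AgreeBelow g D st ξ V V') {f : ℕ → ℕ∞} {J : Set P}
    (hJ : J.Countable) (hJξ : J ⊆ Below st ξ) (hf : Supports g D J f) (m : ℕ) :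
    (∀ᶠ n in V, f n ≠ m) ↔ ∀ᶠ n in V', f n ≠ m := by
  rw [Ultrafilter.eventually_not, Ultrafilter.eventually_not, h f J hJ hJξ hf m]

theorem AgreeBelow.lt_iff (h : AgreeBelow g D st ξ V V') {f : ℕ → ℕ∞} {J : Set P}
    (hJ : J.Countable) (hJξ : J ⊆ Below st ξ) (hf : Supports g D J f) {s : P}
    (hs : s ∈ Below st ξ) : (∀ᶠ n in V, (g s n : ℕ∞) < f n) ↔ ∀ᶠ n in V', (g s n : ℕ∞) < f n := by
  have := h _ _ (hJ.insert s) (insert_subset hs hJξ) (hf.indicator_lt s) 1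
  classical
  simpa [indicator_apply] using this

variable [LinearOrder P]

theorem Requirements.weaken {R R' : Finset P} {M M' n : ℕ} {Φ Φ' : Set ((ℕ → ℕ∞) × Set P)}
    (h : Requirements g st ξ V R M Φ n) (hR : R' ⊆ R) (hM : M' ≤ M) (hΦ : Φ' ⊆ Φ) :
    Requirements g st ξ V R' M' Φ' n :=
  ⟨fun s hs => hM.trans_lt (h.large s (hR hs)),
    fun s hs t ht => h.mono s (hR hs) t (hR ht),
    fun p hp a ha b hb => h.avoid p (hΦ hp) a (hR ha) b (hR hb),
    fun p hp => h.agree p (hΦ hp),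
    fun p hp hpT hinf s hs => h.dominates p (hΦ hp) hpT hinf s (hR hs)⟩

/-- Compactness: the finite parts of the requirements form a directed family, each compatible with
`D` by `frequently_requirements`. -/
theorem exists_extension (hst : Antitone st) (hD : MaxIndependent g D) (hV : ↑V ≤ D)
    (hcut : Cuts g D st (Below st ξ) V) (hdom : ∀ η < ξ, Dominates g D st V η) :
    ∃ V' : Ultrafilter ℕ, ↑V' ≤ D ∧ Cuts g D st univ V' ∧ AgreeBelow g D st ξ V V' ∧
      Dominates g D st V' ξ := by
  classical
  let G := {p : (ℕ → ℕ∞) × Set P // p.2.Countable ∧ Supports g D p.2 p.1}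
  let X : Finset P × ℕ × Finset G → Filter ℕ := fun d =>
    D ⊓ 𝓟 {n | Requirements g st ξ V d.1 d.2.1 ↑(d.2.2.map (Function.Embedding.subtype _)) n}
  have hX : Directed (· ≥ ·) X := by
    rintro ⟨R, M, Φ⟩ ⟨R', M', Φ'⟩
    refine ⟨(R ∪ R', max M M', Φ ∪ Φ'), ?_, ?_⟩
    · refine inf_le_inf_left _ (principal_mono.2 fun n hn => hn.weaken Finset.subset_union_left
        (le_max_left _ _) ?_)
      exact Finset.coe_subset.2 (Finset.map_subset_map.2 Finset.subset_union_left)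
    · refine inf_le_inf_left _ (principal_mono.2 fun n hn => hn.weaken Finset.subset_union_right
        (le_max_right _ _) ?_)
      exact Finset.coe_subset.2 (Finset.map_subset_map.2 Finset.subset_union_right)
  have hne : ∀ d, NeBot (X d) := by
    rintro ⟨R, M, Φ⟩
    refine frequently_iff_neBot.1 (frequently_requirements hst hD hV hcut hdom R M _ ?_ ?_)
    · intro p hp
      obtain ⟨q, -, rfl⟩ := Finset.mem_map.1 hp
      exact q.2.1
    · intro p hp
      obtain ⟨q, -, rfl⟩ := Finset.mem_map.1 hp
      exact q.2.2
  have hL : NeBot (⨅ d, X d) := iInf_neBot_of_directed' hX hne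
  let V' := Ultrafilter.of (⨅ d, X d)
  have hV' : ∀ d, ↑V' ≤ X d := fun d => (Ultrafilter.of_le _).trans (iInf_le _ d)
  have hreq : ∀ (R : Finset P) (M : ℕ) (p : G), ∀ᶠ n in V', Requirements g st ξ V R M {p.1} n := by
    intro R M p
    have := hV' (R, M, {p}) (mem_inf_of_right (mem_principal_self _))
    simp only [Finset.map_singleton, Finset.coe_singleton, Function.Embedding.subtype_apply] at this
    exact this
  have hD' : ↑V' ≤ D := (hV' (∅, 0, ∅)).trans inf_le_left
  obtain ⟨J₀, hJ₀, hs₀⟩ := hD.exists_supports 0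
  let p₀ : G := ⟨(0, J₀), hJ₀, hs₀⟩
  have hagree : AgreeBelow g D st ξ V V' := by
    intro f J hJ hJξ hf m
    refine ⟨fun h => ?_, fun h => ?_⟩
    · exact (hreq ∅ 0 ⟨(f, J), hJ, hf⟩).mono fun n hn => hn.agree _ rfl hJξ m h
    · by_contra hcon
      rw [← Ultrafilter.eventually_not] at hcon
      -- The requirements give agreement in one direction; the converse follows by applying it to
      -- the indicator of the event, which is supported by the same set and vanishes modulo `V`.
      let f' : ℕ → ℕ∞ := {n | f n = m}.indicator 1
      have h0 : ∀ᶠ n in V, f' n = (0 : ℕ) := hcon.mono fun n hn =>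
        (indicator_of_notMem (s := {n | f n = m}) hn (1 : ℕ → ℕ∞)).trans Nat.cast_zero.symm
      have h1 : ∀ᶠ n in V', f' n = (0 : ℕ) :=
        (hreq ∅ 0 ⟨(f', J), hJ, hf.indicator_eq m⟩).mono fun n hn => hn.agree _ rfl hJξ 0 h0
      obtain ⟨n, hn, hn'⟩ := (h.and h1).exists
      have h2 : f' n = 1 := indicator_of_mem (s := {n | f n = m}) hn (1 : ℕ → ℕ∞)
      simp [h2] at hn'
  refine ⟨V', hD', ⟨fun s _ N => ?_, fun s _ t _ hst => ?_,
      fun f J hJ _ hf a _ b _ hab hl hd => ?_⟩,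
    hagree, fun f J hJ hJξ hf hinf s hs => ?_⟩
  · exact (hreq {s} N p₀).mono fun n hn => hn.large s (by simp)
  · exact (hreq {s, t} 0 p₀).mono fun n hn => hn.mono s (by simp) t (by simp) hst
  · exact (hreq {a, b} 0 ⟨(f, J), hJ, hf⟩).mono fun n hn =>
      hn.avoid _ rfl a (by simp) b (by simp) hab hl hd
  · exact (hreq {s} 0 ⟨(f, J), hJ, hf⟩).mono fun n hn =>
      hn.dominates _ rfl hJξ (fun m => (hagree.ne_iff hJ hJξ hf m).2 (hinf m)) s (by simp) hs

/-- `V` is suitable for all stages in `I`, with values prescribed by `U`. -/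
structure Suitable (g : P → ℕ → ℕ) (D : Filter ℕ) (st : P → Ξ) (I : Set Ξ)
    (U : Ξ → Ultrafilter ℕ) (V : Ultrafilter ℕ) : Prop where
  le : ↑V ≤ D
  cuts : Cuts g D st univ V
  agree : ∀ η ∈ I, AgreeBelow g D st η (U η) V
  dominates : ∀ η ∈ I, Dominates g D st V η

theorem Cuts.restrict {Ξ : Type} {st : P → Ξ} {T : Set P} (h : Cuts g D st univ V) :
    Cuts g D st T V :=
  ⟨fun s _ => h.large s trivial, fun s _ t _ => h.mono s trivial t trivial,
    fun f J hJ _ hf a _ b _ => h.avoid f J hJ (subset_univ _) hf a trivial b trivial⟩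

/-- Successor and limit steps are treated alike: each `U ξ` is extended to some `W ξ`, and `V` is
the limit of the `W ξ` along an ultrafilter containing the final segments of `I`. Whatever is true
for all `ξ ≥ η` passes to the limit. -/
theorem exists_suitable [WellFoundedLT Ξ] [Nonempty Ξ] (hst : Antitone st)
    (hD : MaxIndependent g D) {I : Set Ξ} {U : Ξ → Ultrafilter ℕ}
    (h : ∀ ξ ∈ I, Suitable g D st (Iio ξ) U (U ξ)) : ∃ V, Suitable g D st I U V := by
  classical
  have : NeBot D := ⟨fun h => by simpa [h] using hD.frequently ∅ 0⟩
  rcases I.eq_empty_or_nonempty with rfl | hI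
  · obtain ⟨ξ, -, hξ⟩ := (wellFounded_lt (α := Ξ)).has_min univ univ_nonempty
    have hT : Below st ξ = ∅ := eq_empty_of_forall_notMem fun s hs => hξ _ trivial hs
    obtain ⟨V', h1, h2, -, -⟩ := exists_extension (V := Ultrafilter.of D) (ξ := ξ) hst hD
      (Ultrafilter.of_le D) (by rw [hT]; constructor <;> simp)
      fun η hη => absurd hη (hξ η trivial)
    exact ⟨V', h1, h2, by simp, by simp⟩
  · have : Nonempty I := hI.to_subtype
    have hext : ∀ ξ : I, ∃ W : Ultrafilter ℕ, ↑W ≤ D ∧ Cuts g D st univ W ∧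
        AgreeBelow g D st ξ (U ξ) W ∧ Dominates g D st W ξ := fun ξ =>
      exists_extension hst hD (h ξ ξ.2).le (h ξ ξ.2).cuts.restrict (h ξ ξ.2).dominates
    choose W hW1 hW2 hW3 hW4 using hext
    have hagree : ∀ η ξ : I, η ≤ ξ → AgreeBelow g D st η (U η) (W ξ) := by
      intro η ξ hη
      rcases hη.eq_or_lt with rfl | hlt
      · exact hW3 _
      · exact ((h ξ ξ.2).agree η hlt).trans ((hW3 ξ).mono hη)
    have hdom : ∀ η ξ : I, η ≤ ξ → Dominates g D st (W ξ) η := by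
      intro η ξ hη f J hJ hJη hf hinf s hs
      have hJξ : J ⊆ Below st ξ.1 := hJη.trans fun r (hr : _ < η.1) => hr.trans_le hη
      by_cases hsξ : s ∈ Below st ξ.1
      · rcases hη.eq_or_lt with rfl | hlt
        · exact absurd hsξ hs
        rw [← (hW3 ξ).lt_iff hJ hJξ hf hsξ]
        exact (h ξ ξ.2).dominates η hlt f J hJ hJη hf
          (fun m => ((hW3 ξ).ne_iff hJ hJξ hf m).2 (hinf m)) s hs
      · exact hW4 ξ f J hJ hJξ hf hinf s hsξ
    let 𝒰 : Ultrafilter I := Ultrafilter.of atTop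
    let V' : Ultrafilter ℕ := 𝒰.bind W
    have hV' : ∀ (η : I) (p : ℕ → Prop), (∀ ξ : I, η ≤ ξ → ∀ᶠ n in W ξ, p n) → ∀ᶠ n in V', p n :=
      fun η p hp => Ultrafilter.of_le atTop (mem_of_superset (mem_atTop η) fun ξ hξ => hp ξ hξ)
    have hV'' : ∀ p : ℕ → Prop, (∀ ξ : I, ∀ᶠ n in W ξ, p n) → ∀ᶠ n in V', p n :=
      fun p hp => hV' (Classical.arbitrary I) p fun ξ _ => hp ξ
    have hVagree : ∀ η ∈ I, AgreeBelow g D st η (U η) V' := by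
      intro η hη f J hJ hJη hf m
      refine ⟨fun hm => hV' ⟨η, hη⟩ _ fun ξ hξ => ?_, fun hm => ?_⟩
      · exact (hagree ⟨η, hη⟩ ξ hξ f J hJ hJη hf m).1 hm
      · by_contra hcon
        rw [← Ultrafilter.eventually_not] at hcon
        have := hV' ⟨η, hη⟩ (fun n => f n ≠ m) fun ξ hξ =>
          ((hagree ⟨η, hη⟩ ξ hξ).ne_iff hJ hJη hf m).1 hcon
        obtain ⟨n, hn, hn'⟩ := (hm.and this).exists
        exact hn' hn
    refine ⟨V', fun A hA => hV'' _ fun ξ => hW1 ξ hA, ⟨?_, ?_, ?_⟩, hVagree, ?_⟩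
    · exact fun s hs N => hV'' _ fun ξ => (hW2 ξ).large s hs N
    · exact fun s hs t ht hst => hV'' _ fun ξ => (hW2 ξ).mono s hs t ht hst
    · exact fun f J hJ hJT hf a ha b hb hab hl hd => hV'' _ fun ξ =>
        (hW2 ξ).avoid f J hJ hJT hf a ha b hb hab hl hd
    · intro η hη f J hJ hJη hf hinf s hs
      refine hV' ⟨η, hη⟩ _ fun ξ hξ => hdom ⟨η, hη⟩ ξ hξ f J hJ hJη hf (fun m => ?_) s hs
      rw [← (hagree ⟨η, hη⟩ ξ hξ).ne_iff hJ hJη hf, (hVagree η hη).ne_iff hJ hJη hf]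
      exact hinf m

theorem exists_suitable_sequence [WellFoundedLT Ξ] [Nonempty Ξ] (hst : Antitone st)
    (hD : MaxIndependent g D) :
    ∃ U : Ξ → Ultrafilter ℕ, ∀ ξ, Suitable g D st (Iio ξ) U (U ξ) := by
  classical
  have hext : ∀ (ξ : Ξ) (U : ∀ η, η < ξ → Ultrafilter ℕ), ∃ V : Ultrafilter ℕ,
      ∀ U' : Ξ → Ultrafilter ℕ, (∀ η h, U' η = U η h) →
        (∃ W, Suitable g D st (Iio ξ) U' W) → Suitable g D st (Iio ξ) U' V := by
    intro ξ U
    by_cases h : ∃ W, Suitable g D st (Iio ξ) (fun η => if h : η < ξ then U η h else pure 0) W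
    · obtain ⟨W, hW⟩ := h
      refine ⟨W, fun U' hU' _ => ⟨hW.le, hW.cuts, fun η hη => ?_, hW.dominates⟩⟩
      have := hW.agree η hη
      rwa [dif_pos (show η < ξ from hη), ← hU' η hη] at this
    · refine ⟨pure 0, fun U' hU' ⟨W, hW⟩ => absurd ⟨W, hW.le, hW.cuts, fun η hη => ?_,
        hW.dominates⟩ h⟩
      rw [dif_pos (show η < ξ from hη), ← hU' η hη]
      exact hW.agree η hη
  choose E hE using hext
  let U : Ξ → Ultrafilter ℕ := wellFounded_lt.fix E
  have hU : ∀ ξ, U ξ = E ξ fun η _ => U η := fun ξ => wellFounded_lt.fix_eq E ξ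
  refine ⟨U, fun ξ => ?_⟩
  induction ξ using WellFoundedLT.induction with
  | ind ξ ih =>
    rw [hU ξ]
    exact hE ξ _ U (fun _ _ => rfl) (exists_suitable hst hD ih)

/-- An ultrafilter on `ℕ` whose ultrapower of `ℕ` has the order `P` nicely embedded above `ω`. -/
theorem exists_ultrafilter [WellFoundedLT Ξ] [Nonempty Ξ] (hst : Antitone st) (hP : #P ≤ 𝔠)
    (hΞ : ∀ s : Set Ξ, s.Countable → ∃ ξ, ∀ η ∈ s, η < ξ) :
    ∃ (V : Ultrafilter ℕ) (g : P → ℕ → ℕ), (∀ s, ∀ N : ℕ, ∀ᶠ n in V, N < g s n) ∧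
      (∀ s t, s < t → ∀ᶠ n in V, g s n < g t n) ∧
      (∀ f : ℕ → ℕ, ∃ J : Set P, J.Countable ∧ ∀ a b, a < b → Linked st a b →
        Disjoint J (Icc a b) → ¬ ∀ᶠ n in V, g a n ≤ f n ∧ f n ≤ g b n) ∧
      ∀ f : ℕ → ℕ, (∀ N : ℕ, ∀ᶠ n in V, N < f n) →
        ∃ ξ, ∀ s, ξ ≤ st s → ∀ᶠ n in V, g s n < f n := by
  obtain ⟨g, hg⟩ := exists_independent_family hP
  obtain ⟨D, hD⟩ := exists_maxIndependent hg
  obtain ⟨U, hU⟩ := exists_suitable_sequence hst hD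
  obtain ⟨V, hV⟩ := exists_suitable (I := univ) hst hD fun ξ _ => hU ξ
  refine ⟨V, g, fun s N => hV.cuts.large s trivial N, fun s t => hV.cuts.mono s trivial t trivial,
    fun f => ?_, fun f hf => ?_⟩
  · obtain ⟨J, hJ, hJf⟩ := hD.exists_supports fun n => f n
    refine ⟨J, hJ, fun a b hab hl hd h => ?_⟩
    obtain ⟨n, hn, hn'⟩ := (h.and (hV.cuts.avoid _ J hJ (subset_univ _) hJf a trivial b trivial hab
      hl hd)).exists
    exact hn' ⟨Nat.cast_le.2 hn.1, Nat.cast_le.2 hn.2⟩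
  · obtain ⟨J, hJ, hJf⟩ := hD.exists_supports fun n => f n
    obtain ⟨ξ, hξ⟩ := hΞ (st '' J) (hJ.image st)
    refine ⟨ξ, fun s hs => ?_⟩
    have := hV.dominates ξ trivial _ J hJ (fun r hr => hξ _ (mem_image_of_mem _ hr)) hJf
      (fun m => (hf m).mono fun n hn h => hn.ne' (Nat.cast_injective h)) s hs.not_gt
    exact this.mono fun n hn => Nat.cast_lt.1 hn

end

/-! ### The order that realizes prescribed bits -/

section

variable {X : Type} [LinearOrder X] {Θ : X → Type} [∀ i, LinearOrder (Θ i)]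

/-- The blocks `(a i ε)ᵒᵈ` for fixed `i`, increasing with `ε`. -/
abbrev LadderBlock (a : ∀ i, Θ i → Bool) (i : X) : Type := Σₗ ε : Θ i, (OmegaBit (a i ε))ᵒᵈ

/-- The orders `LadderBlock a i`, each with a bottom element added, decreasing with `i`. -/
abbrev LadderOrder (a : ∀ i, Θ i → Bool) : Type :=
  Σₗ i : Xᵒᵈ, WithBot (LadderBlock a i.ofDual)

namespace LadderOrder

variable (a : ∀ i, Θ i → Bool)

/-- The bottom element of `LadderBlock a i`. -/
def bot (i : X) : LadderOrder a := toLex ⟨OrderDual.toDual i, ⊥⟩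

/-- The element `ζ` of the block `(a i ε)ᵒᵈ`. -/
def pt (i : X) (ε : Θ i) (ζ : OmegaBit (a i ε)) : LadderOrder a :=
  toLex ⟨OrderDual.toDual i, ((toLex ⟨ε, OrderDual.toDual ζ⟩ : LadderBlock a i) :
    WithBot (LadderBlock a i))⟩

open Classical in
/-- The stage at which an element is treated. -/
noncomputable def stage (s : LadderOrder a) : X ×ₗ Bool :=
  toLex ((ofLex s).1.ofDual, decide ((ofLex s).2 = ⊥))

theorem eq_bot_or_pt (s : LadderOrder a) : (∃ i, s = bot a i) ∨ ∃ i ε ζ, s = pt a i ε ζ := by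
  obtain ⟨i, _ | x⟩ := s
  · exact .inl ⟨i.ofDual, rfl⟩
  · exact .inr ⟨i.ofDual, x.1, x.2.ofDual, rfl⟩

variable {a}

theorem stage_bot (i : X) : stage a (bot a i) = toLex (i, true) := by
  exact congrArg (fun b => toLex (i, b)) (decide_eq_true (Eq.refl (⊥ : WithBot (LadderBlock a i))))

theorem stage_pt (i : X) (ε : Θ i) (ζ : OmegaBit (a i ε)) :
    stage a (pt a i ε ζ) = toLex (i, false) := by
  exact congrArg (fun b => toLex (i, b))
    (decide_eq_false (WithBot.coe_ne_bot (α := LadderBlock a i)))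

theorem bot_lt_bot {i j : X} (h : j < i) : bot a i < bot a j := Sigma.Lex.left _ _ h

theorem bot_lt_pt {i j : X} {ε : Θ j} {ζ : OmegaBit (a j ε)} (h : j ≤ i) :
    bot a i < pt a j ε ζ := by
  rcases h.lt_or_eq with h | rfl
  · exact Sigma.Lex.left _ _ h
  · exact Sigma.Lex.right _ _ (WithBot.bot_lt_coe _)

theorem pt_lt_bot {i j : X} {ε : Θ i} {ζ : OmegaBit (a i ε)} (h : j < i) :
    pt a i ε ζ < bot a j := Sigma.Lex.left _ _ h

theorem pt_lt_pt_of_gt {i j : X} {ε : Θ i} {ζ : OmegaBit (a i ε)} {η : Θ j}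
    {θ : OmegaBit (a j η)} (h : j < i) : pt a i ε ζ < pt a j η θ := Sigma.Lex.left _ _ h

theorem pt_lt_pt_of_lt {i : X} {ε η : Θ i} {ζ : OmegaBit (a i ε)} {θ : OmegaBit (a i η)}
    (h : ε < η) : pt a i ε ζ < pt a i η θ :=
  Sigma.Lex.right _ _ (WithBot.coe_lt_coe.2 (Sigma.Lex.left _ _ h))

theorem pt_lt_pt {i : X} {ε : Θ i} {ζ θ : OmegaBit (a i ε)} (h : θ < ζ) :
    pt a i ε ζ < pt a i ε θ :=
  Sigma.Lex.right _ _ (WithBot.coe_lt_coe.2 (Sigma.Lex.right _ _ h))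

theorem antitone_stage : Antitone (stage a) := by
  intro s t hst
  by_contra hcon
  rw [not_le] at hcon
  refine hst.not_gt ?_
  rcases eq_bot_or_pt a s with ⟨i, rfl⟩ | ⟨i, ε, ζ, rfl⟩ <;>
    rcases eq_bot_or_pt a t with ⟨j, rfl⟩ | ⟨j, η, θ, rfl⟩ <;>
    simp only [stage_bot, stage_pt, Prod.Lex.toLex_lt_toLex] at hcon
  · exact bot_lt_bot (by simpa using hcon)
  · rcases hcon with h | ⟨_, h⟩
    · exact pt_lt_bot h
    · cases h
  · rcases hcon with h | ⟨h, _⟩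
    · exact bot_lt_pt h.le
    · exact bot_lt_pt h.le
  · exact pt_lt_pt_of_gt (by simpa using hcon)

/-- This is the purpose of the Boolean in `stage`: it gives each bottom element a stage of its own,
after that of the block above it. -/
theorem linked_bot (s : LadderOrder a) (i : X) : Linked (stage a) s (bot a i) := by
  refine .inr fun r hr => ?_
  rcases eq_bot_or_pt a r with ⟨j, rfl⟩ | ⟨j, η, θ, rfl⟩
  · simp only [stage_bot, toLex_inj, Prod.mk.injEq, and_true] at hr
    rw [hr]
  · simp [stage_bot, stage_pt] at hr

theorem linked_pt (i : X) (ε η : Θ i) (ζ : OmegaBit (a i ε)) (θ : OmegaBit (a i η)) :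
    Linked (stage a) (pt a i ε ζ) (pt a i η θ) := .inl (by simp [stage_pt])

theorem mk_le (hX : #X ≤ 𝔠) (hΘ : ∀ i, #(Θ i) ≤ 𝔠) (h2 : ℵ_ 2 ≤ (𝔠 : Cardinal.{0})) :
    #(LadderOrder a) ≤ 𝔠 := by
  have hb : ∀ b, #(OmegaBit b)ᵒᵈ ≤ 𝔠 := by
    rintro (_ | _)
    · exact mk_Omega2.le.trans h2
    · exact mk_Omega1.le.trans (aleph_one_lt_aleph_two.le.trans h2)
  have hs : ∀ {ι : Type} {A : ι → Type}, #ι ≤ 𝔠 → (∀ i, #(A i) ≤ 𝔠) → #(Σ i, A i) ≤ 𝔠 := by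
    intro ι A hι hA
    rw [mk_sigma]
    refine (sum_le_sum _ (fun _ => 𝔠) hA).trans ?_
    rw [sum_const']
    exact (mul_le_mul_left hι _).trans (by simp)
  refine hs (A := fun i : Xᵒᵈ => WithBot (LadderBlock a i.ofDual)) hX fun i => ?_
  refine (mk_option (α := LadderBlock a i.ofDual)).le.trans ?_
  exact add_le_of_le aleph0_le_continuum (hs (hΘ _) fun ε => hb _)
    (nat_lt_continuum 1 |>.le.trans' (by simp))

theorem exists_stage_gt [UncountableRegular X] (s : Set (X ×ₗ Bool)) (hs : s.Countable) :
    ∃ ξ, ∀ η ∈ s, η < ξ := by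
  obtain ⟨i, hi⟩ := exists_gt_of_countable (hs.image fun p => (ofLex p).1)
  exact ⟨toLex (i, true), fun p hp => Prod.Lex.left _ _ (hi _ (mem_image_of_mem _ hp))⟩

end LadderOrder

open LadderOrder

/-- An element `y` with countable support `J` lies between no two linked elements with no member of
`J` between them. If a chain failed to reach past `y`, such a pair would exist: cofinality `ω₁`
moves one end past the countably many indices occurring in `J`, uncountable regularity of the chain
moves the other. -/
theorem exists_ladder [UncountableRegular X] [∀ i, UncountableRegular (Θ i)] (hX : #X ≤ 𝔠)
    (hΘ : ∀ i, #(Θ i) ≤ 𝔠) (h2 : ℵ_ 2 ≤ (𝔠 : Cardinal.{0})) (a : ∀ i, Θ i → Bool) :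
    ∃ μ : NonprincipalUltrafilter, Nonempty (Ladder Θ a (AboveOmega μ)) := by
  obtain ⟨V, g, hlarge, hmono, havoid, hdom⟩ := exists_ultrafilter (st := stage a) antitone_stage
    (mk_le hX hΘ h2) exists_stage_gt
  have hV : ∀ n : ℕ, V ≠ pure n := by
    rintro n rfl
    have := hlarge (bot a (Classical.arbitrary X)) (g (bot a (Classical.arbitrary X)) n)
    simp at this
  let μ : NonprincipalUltrafilter := ⟨V, hV⟩
  let φ : LadderOrder a → AboveOmega μ := fun s =>
    ⟨(g s : Robinson.HyperN μ), fun n => Filter.Germ.coe_lt.2 (hlarge s n)⟩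
  have hφ : StrictMono φ := fun s t hst => Filter.Germ.coe_lt.2 (hmono s t hst)
  have hgap : ∀ y : AboveOmega μ, ∃ J : Set (LadderOrder a), J.Countable ∧ ∀ s t, s < t →
      Linked (stage a) s t → Disjoint J (Icc s t) → ¬ (φ s ≤ y ∧ y ≤ φ t) := by
    rintro ⟨y, hy⟩
    induction y using Filter.Germ.inductionOn with
    | h f =>
      obtain ⟨J, hJ, hJf⟩ := havoid f
      exact ⟨J, hJ, fun s t hst hl hd ⟨h1, h2⟩ =>
        hJf s t hst hl hd ((Filter.Germ.coe_le.1 h1).and (Filter.Germ.coe_le.1 h2))⟩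
  let z : ∀ i ε, OmegaBit (a i ε) := fun i ε => Classical.arbitrary _
  have hbelow : ∀ (J : Set (LadderOrder a)) (i : X), J.Countable →
      {ε | ∃ ζ, pt a i ε ζ ∈ J}.Countable := by
    intro J i hJ
    classical
    let w : Θ i → LadderOrder a := fun ε =>
      if h : ∃ ζ, pt a i ε ζ ∈ J then pt a i ε h.choose else bot a i
    have hw : ∀ ε, (∃ ζ, pt a i ε ζ ∈ J) → ∃ ζ, w ε = pt a i ε ζ ∧ pt a i ε ζ ∈ J :=
      fun ε h => ⟨h.choose, dif_pos h, h.choose_spec⟩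
    refine MapsTo.countable_of_injOn (f := w) (t := J) (fun ε h => ?_) (fun ε h ε' h' heq => ?_) hJ
    · obtain ⟨ζ, h1, h2⟩ := hw ε h
      rwa [h1]
    · obtain ⟨ζ, h1, -⟩ := hw ε h
      obtain ⟨ζ', h1', -⟩ := hw ε' h'
      rw [h1, h1'] at heq
      rcases lt_trichotomy ε ε' with hlt | rfl | hlt
      · exact absurd heq (pt_lt_pt_of_lt hlt).ne
      · rfl
      · exact absurd heq (pt_lt_pt_of_lt hlt).ne'
  refine ⟨μ, ⟨{
    c := fun i => φ (bot a i)
    c_anti := fun i j h => hφ (bot_lt_bot h)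
    c_coinitial := ?_
    h := fun i ε => φ (pt a i ε (z i ε))
    h_mono := fun i ε ε' h => hφ (pt_lt_pt_of_lt h)
    h_lt_c := fun i j ε h => hφ (pt_lt_bot h)
    h_cofinal := ?_
    m := fun i ε ζ => φ (pt a i ε ζ)
    m_anti := fun i ε ζ ζ' h => hφ (pt_lt_pt h)
    m_lt_c := fun i j ε ζ h => hφ (pt_lt_bot h)
    h_lt_m := fun i ε' ε ζ h => hφ (pt_lt_pt_of_lt h)
    m_coinitial := ?_ }⟩⟩
  · rintro ⟨y, hy⟩
    induction y using Filter.Germ.inductionOn with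
    | h f =>
      obtain ⟨ξ, hξ⟩ := hdom f fun N => Filter.Germ.coe_lt.1 (hy N)
      refine ⟨(ofLex ξ).1, Filter.Germ.coe_lt.2 (hξ _ ?_)⟩
      rw [stage_bot]
      exact Prod.Lex.right _ le_top
  · intro δ hδ y hy
    obtain ⟨J, hJ, hJy⟩ := hgap y
    obtain ⟨i, hi, hiJ⟩ := hδ.exists_gt_of_countable
      (s := {i | i < δ ∧ i ∈ (fun s : LadderOrder a => (ofLex s).1.ofDual) '' J})
      ((hJ.image _).mono fun i hi => hi.2) fun i hi => hi.1
    obtain ⟨ε, hε⟩ := exists_gt_of_countable (hbelow J δ hJ)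
    refine ⟨ε, not_le.1 fun hle => ?_⟩
    -- The pair is `h δ ε` and `c i`: no member of `J` has index from `i` up to but excluding `δ`,
    -- and `J` meets no block of `δ` from `ε` on.
    refine hJy _ _ (pt_lt_bot hi) (linked_bot _ _) ?_ ⟨hle, (hy i hi).le⟩
    refine disjoint_left.2 fun r hr ⟨hr1, hr2⟩ => ?_
    rcases eq_bot_or_pt a r with ⟨j, rfl⟩ | ⟨j, η, θ, rfl⟩
    · rcases lt_or_ge j δ with h | h
      · exact hr2.not_gt (bot_lt_bot (hiJ j ⟨h, _, hr, rfl⟩))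
      · exact hr1.not_gt (bot_lt_pt h)
    · rcases lt_trichotomy j δ with h | rfl | h
      · exact hr2.not_gt (bot_lt_pt (hiJ j ⟨h, _, hr, rfl⟩).le)
      · exact hr1.not_gt (pt_lt_pt_of_lt (hε η ⟨θ, hr⟩))
      · exact hr1.not_gt (pt_lt_pt_of_gt h)
  · intro i ε hε y hy
    obtain ⟨J, hJ, hJy⟩ := hgap y
    obtain ⟨ε₀, hε₀, hεJ⟩ := hε.exists_gt_of_countable (s := {η | η < ε ∧ ∃ ζ, pt a i η ζ ∈ J})
      ((hbelow J i hJ).mono fun η hη => hη.2) fun η hη => hη.1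
    have hinj : Function.Injective (pt a i ε) := StrictAnti.injective fun _ _ => pt_lt_pt
    obtain ⟨ζ, hζ⟩ := exists_gt_of_countable (hJ.preimage_of_injOn hinj.injOn)
    refine ⟨ζ, not_le.1 fun hle => ?_⟩
    -- Between `ε₀` and `ε` the set `J` meets no block, and in the block `ε` it has no element at or
    -- below `ζ`.
    refine hJy _ _ (pt_lt_pt_of_lt hε₀) (linked_pt _ _ _ _ _) ?_ ⟨(hy ε₀ hε₀).le, hle⟩
    refine disjoint_left.2 fun r hr ⟨hr1, hr2⟩ => ?_
    rcases eq_bot_or_pt a r with ⟨j, rfl⟩ | ⟨j, η, θ, rfl⟩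
    · rcases lt_or_ge j i with h | h
      · exact hr2.not_gt (pt_lt_bot h)
      · exact hr1.not_gt (bot_lt_pt h)
    · rcases lt_trichotomy j i with h | rfl | h
      · exact hr2.not_gt (pt_lt_pt_of_gt h)
      · rcases lt_trichotomy η ε with h | rfl | h
        · exact hr1.not_gt (pt_lt_pt_of_lt (hεJ η ⟨h, θ, hr⟩))
        · exact hr2.not_gt (pt_lt_pt (hζ θ hr))
        · exact hr2.not_gt (pt_lt_pt_of_lt h)
      · exact hr1.not_gt (pt_lt_pt_of_gt h)

end

/-! ### From field isomorphisms to isomorphisms of initial segments -/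

open Robinson

section

variable {μ ν : NonprincipalUltrafilter}

theorem mem_M0_of_abs_le {s t : HyperR μ} (h : |s| ≤ |t|) (ht : t ∈ M0 μ) : s ∈ M0 μ := by
  obtain ⟨k, hk⟩ := ht
  exact ⟨k, h.trans_lt hk⟩

/-- The projection of `M₀` onto the Robinson field. -/
def robinsonMk : M0 μ →+* RobinsonField μ := Ideal.Quotient.mk (M1 μ)

theorem robinsonMk_surjective : Function.Surjective (robinsonMk (μ := μ)) :=
  Ideal.Quotient.mk_surjective

theorem robinsonMk_eq_zero_iff {t : M0 μ} : robinsonMk t = 0 ↔ t ∈ M1 μ :=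
  Ideal.Quotient.eq_zero_iff_mem

theorem exists_sq_eq {t : HyperR μ} (ht : 0 ≤ t) : ∃ s : HyperR μ, t = s * s := by
  induction t using Filter.Germ.inductionOn with
  | h f =>
    refine ⟨((fun n => √(f n) : ℕ → ℝ) : HyperR μ), ?_⟩
    rw [← Filter.Germ.coe_mul]
    refine Filter.Germ.coe_eq.2 ?_
    filter_upwards [Filter.Germ.coe_le.1 ht] with n hn
    exact (Real.mul_self_sqrt hn).symm

/-- Square roots exist in `*ℝ`, and `s * s ∈ M₀` implies `s ∈ M₀` because `|s| ≤ 1 + s * s`. With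
the converse `exists_of_isSquare`, this makes the order definable in the field. -/
theorem isSquare_robinsonMk {t : M0 μ} (ht : 0 ≤ (t : HyperR μ)) : IsSquare (robinsonMk t) := by
  obtain ⟨s, hs⟩ := exists_sq_eq ht
  have hs0 : s ∈ M0 μ := by
    refine mem_M0_of_abs_le (t := 1 + (t : HyperR μ)) ?_ (add_mem (one_mem _) t.2)
    rw [abs_of_nonneg (a := 1 + (t : HyperR μ)) (by linarith), hs]
    nlinarith [abs_mul_abs_self s, sq_nonneg (|s| - 1), abs_nonneg s]
  exact ⟨robinsonMk ⟨s, hs0⟩, by rw [← map_mul]; exact congrArg _ (Subtype.ext hs)⟩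

theorem exists_of_isSquare {u : RobinsonField μ} (hu : IsSquare u) :
    ∃ t : M0 μ, 0 ≤ (t : HyperR μ) ∧ robinsonMk t = u := by
  obtain ⟨v, rfl⟩ := hu
  obtain ⟨s, rfl⟩ := robinsonMk_surjective v
  exact ⟨s * s, mul_self_nonneg _, map_mul _ _ _⟩

theorem isSquare_add {u v : RobinsonField μ} (hu : IsSquare u) (hv : IsSquare v) :
    IsSquare (u + v) := by
  obtain ⟨s, hs, rfl⟩ := exists_of_isSquare hu
  obtain ⟨t, ht, rfl⟩ := exists_of_isSquare hv
  rw [← map_add]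
  exact isSquare_robinsonMk (add_nonneg hs ht)

theorem isSquare_or_neg (u : RobinsonField μ) : IsSquare u ∨ IsSquare (-u) := by
  obtain ⟨t, rfl⟩ := robinsonMk_surjective u
  rcases le_total 0 (t : HyperR μ) with h | h
  · exact .inl (isSquare_robinsonMk h)
  · rw [← map_neg]
    exact .inr (isSquare_robinsonMk (neg_nonneg.2 h))

theorem eq_zero_of_isSquare_neg {u : RobinsonField μ} (hu : IsSquare u) (hu' : IsSquare (-u)) :
    u = 0 := by
  obtain ⟨s, hs, rfl⟩ := exists_of_isSquare hu
  obtain ⟨t, ht, h⟩ := exists_of_isSquare hu'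
  have hst : s + t ∈ M1 μ := by
    rw [← robinsonMk_eq_zero_iff, map_add, h, add_neg_cancel]
  refine robinsonMk_eq_zero_iff.2 fun k => ?_
  refine lt_of_le_of_lt ?_ (hst k)
  have : ((s + t : M0 μ) : HyperR μ) = s + t := rfl
  rw [this, abs_of_nonneg hs, abs_of_nonneg (add_nonneg hs ht)]
  linarith

open Classical in
noncomputable instance : LinearOrder (RobinsonField μ) where
  le u v := IsSquare (v - u)
  le_refl u := by simp
  le_trans u v w h h' := by simpa using isSquare_add h h'
  le_antisymm u v h h' := by
    refine (sub_eq_zero.1 (eq_zero_of_isSquare_neg h ?_)).symm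
    rwa [neg_sub]
  le_total u v := by simpa using isSquare_or_neg (v - u)
  toDecidableLE := inferInstance

theorem RobinsonField.le_iff_isSquare {u v : RobinsonField μ} : u ≤ v ↔ IsSquare (v - u) := Iff.rfl

instance : IsOrderedAddMonoid (RobinsonField μ) where
  add_le_add_left u v h w := by
    rw [RobinsonField.le_iff_isSquare] at h ⊢
    simpa using h

instance : ZeroLEOneClass (RobinsonField μ) where
  zero_le_one := by simp [RobinsonField.le_iff_isSquare]

instance : IsStrictOrderedRing (RobinsonField μ) :=
  .of_mul_pos fun u v hu hv => by
    refine lt_of_le_of_ne ?_ (mul_ne_zero hu.ne' hv.ne').symm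
    have hu' := hu.le
    have hv' := hv.le
    rw [RobinsonField.le_iff_isSquare, sub_zero] at hu' hv' ⊢
    exact hu'.mul hv'

theorem robinsonMk_le {s t : M0 μ} (h : (s : HyperR μ) ≤ t) : robinsonMk s ≤ robinsonMk t := by
  rw [RobinsonField.le_iff_isSquare, ← map_sub]
  exact isSquare_robinsonMk (sub_nonneg.2 h)

theorem RingEquiv.robinsonField_le_iff (e : RobinsonField μ ≃+* RobinsonField ν)
    {u v : RobinsonField μ} : e u ≤ e v ↔ u ≤ v := by
  rw [RobinsonField.le_iff_isSquare, RobinsonField.le_iff_isSquare, ← map_sub]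
  refine ⟨fun h => ?_, fun h => h.map e⟩
  have := h.map e.symm
  rwa [e.symm_apply_apply] at this

/-- The embedding of `*ℕ` into `*ℝ`. -/
noncomputable def hyperCast (x : HyperN μ) : HyperR μ := Filter.Germ.map (fun n : ℕ => (n : ℝ)) x

theorem hyperCast_le {x y : HyperN μ} : hyperCast x ≤ hyperCast y ↔ x ≤ y := by
  induction x, y using Filter.Germ.inductionOn₂ with
  | h f g =>
    refine Filter.Germ.coe_le.trans (Iff.trans ?_ Filter.Germ.coe_le.symm)
    simp [EventuallyLE]

theorem hyperCast_add_one (x : HyperN μ) : hyperCast (x + 1) = hyperCast x + 1 := by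
  induction x using Filter.Germ.inductionOn with
  | h f => exact Filter.Germ.coe_eq.2 (Eventually.of_forall fun n => Nat.cast_succ _)

theorem hyperCast_nonneg (x : HyperN μ) : 0 ≤ hyperCast x := by
  induction x using Filter.Germ.inductionOn with
  | h f => exact Filter.Germ.coe_le.2 (Eventually.of_forall fun n => Nat.cast_nonneg _)

theorem add_one_le_of_lt {x y : HyperN μ} (h : x < y) : x + 1 ≤ y := by
  induction x, y using Filter.Germ.inductionOn₂ with
  | h f g => exact Filter.Germ.coe_le.2 ((Filter.Germ.coe_lt.1 h).mono fun n hn => hn)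

theorem exists_hyperCast_floor {t : HyperR μ} (ht : 0 ≤ t) :
    ∃ x : HyperN μ, hyperCast x ≤ t ∧ t < hyperCast x + 1 := by
  induction t using Filter.Germ.inductionOn with
  | h f =>
    refine ⟨((fun n => ⌊f n⌋₊ : ℕ → ℕ) : HyperN μ), Filter.Germ.coe_le.2 ?_,
      Filter.Germ.coe_lt.2 ?_⟩
    · filter_upwards [Filter.Germ.coe_le.1 ht] with n hn using Nat.floor_le hn
    · exact Eventually.of_forall fun n => Nat.lt_floor_add_one _

/-- The elements of `*ℕ` above `ω` that belong to `M₀`. -/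
def tameInfinite (μ : NonprincipalUltrafilter) : Set (AboveOmega μ) :=
  {x | hyperCast x.1 ∈ M0 μ}

theorem isLowerSet_tameInfinite : IsLowerSet (tameInfinite μ) := by
  intro x y hyx hx
  refine mem_M0_of_abs_le ?_ hx
  rw [abs_of_nonneg (hyperCast_nonneg _), abs_of_nonneg (hyperCast_nonneg _)]
  exact hyperCast_le.2 hyx

theorem tameInfinite_nonempty : (tameInfinite μ).Nonempty := by
  refine ⟨⟨((fun n => n : ℕ → ℕ) : HyperN μ), fun n => Filter.Germ.coe_lt.2 ?_⟩, 1, ?_⟩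
  · exact le_cofinite μ (Nat.cofinite_eq_atTop ▸ eventually_gt_atTop n)
  · rw [abs_of_nonneg (hyperCast_nonneg _), pow_one]
    refine Filter.Germ.coe_lt.2 (Eventually.of_forall fun n => ?_)
    simp only [Function.comp_apply, Real.exp_neg, inv_inv]
    linarith [Real.add_one_le_exp (n : ℝ)]

instance : Nonempty (AboveOmega μ) := tameInfinite_nonempty.to_type

/-- The class of a tame infinite number in the Robinson field. -/
noncomputable def tameClass (x : tameInfinite μ) : RobinsonField μ := robinsonMk ⟨_, x.2⟩

theorem tameClass_mono {x y : tameInfinite μ} (h : x ≤ y) : tameClass x ≤ tameClass y :=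
  robinsonMk_le (hyperCast_le.2 h)

theorem tameClass_add_one_le {x y : tameInfinite μ} (h : x < y) :
    tameClass x + 1 ≤ tameClass y := by
  rw [tameClass, tameClass, ← map_one robinsonMk, ← map_add]
  refine robinsonMk_le ?_
  have := hyperCast_le.2 (add_one_le_of_lt (show x.1.1 < y.1.1 from h))
  rwa [hyperCast_add_one] at this

theorem natCast_le_tameClass (n : ℕ) (x : tameInfinite μ) : n ≤ tameClass x := by
  rw [tameClass, ← map_natCast robinsonMk]
  exact robinsonMk_le (hyperCast_le.2 (x.1.2 n).le)

theorem exists_succ (x : tameInfinite μ) : ∃ y : tameInfinite μ, tameClass y = tameClass x + 1 := by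
  have hmem : hyperCast (x.1.1 + 1) ∈ M0 μ := by
    rw [hyperCast_add_one]
    exact add_mem x.2 (one_mem _)
  have hlt : x.1.1 ≤ x.1.1 + 1 := by
    rw [← hyperCast_le, hyperCast_add_one]
    linarith
  refine ⟨⟨⟨x.1.1 + 1, fun n => (x.1.2 n).trans_le hlt⟩, hmem⟩, ?_⟩
  rw [tameClass, tameClass, ← map_one robinsonMk, ← map_add]
  exact congrArg _ (Subtype.ext (hyperCast_add_one _))

theorem exists_tame_floor {u : RobinsonField μ} (hu : ∀ n : ℕ, n ≤ u) :
    ∃ x : tameInfinite μ, tameClass x ≤ u ∧ u < tameClass x + 1 := by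
  have key : ∃ x : HyperN μ, ∃ hx : hyperCast x ∈ M0 μ,
      robinsonMk ⟨_, hx⟩ ≤ u ∧ u < robinsonMk ⟨_, hx⟩ + 1 := by
    obtain ⟨t, ht, rfl⟩ := exists_of_isSquare (u := u) (by
      have := hu 0
      rwa [Nat.cast_zero, RobinsonField.le_iff_isSquare, sub_zero] at this)
    obtain ⟨x, hx, hx'⟩ := exists_hyperCast_floor ht
    have hmem : hyperCast x ∈ M0 μ := mem_M0_of_abs_le
      (by rwa [abs_of_nonneg ht, abs_of_nonneg (hyperCast_nonneg _)]) t.2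
    have h1 : robinsonMk ⟨_, hmem⟩ ≤ robinsonMk t := robinsonMk_le hx
    have h2 : robinsonMk t ≤ robinsonMk ⟨_, hmem⟩ + 1 := by
      rw [← map_one robinsonMk, ← map_add]
      exact robinsonMk_le hx'.le
    -- The strict inequality `t < x + 1` can become an equality modulo `M₁`; then `x + 1` is the
    -- integer part.
    rcases h2.lt_or_eq with h2 | h2
    · exact ⟨x, hmem, h1, h2⟩
    · have hmem' : hyperCast (x + 1) ∈ M0 μ := by
        rw [hyperCast_add_one]
        exact add_mem hmem (one_mem _)
      have h3 : robinsonMk ⟨_, hmem'⟩ = robinsonMk t := by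
        rw [h2, ← map_one robinsonMk, ← map_add]
        exact congrArg _ (Subtype.ext (hyperCast_add_one _))
      exact ⟨x + 1, hmem', h3.le, by rw [h3]; exact lt_add_one _⟩
  obtain ⟨x, hmem, h1, h2⟩ := key
  refine ⟨⟨⟨x, fun n => not_le.1 fun hxn => ?_⟩, hmem⟩, h1, h2⟩
  have h3 : robinsonMk ⟨_, hmem⟩ ≤ robinsonMk (n : M0 μ) := robinsonMk_le (hyperCast_le.2 hxn)
  have h4 := hu (n + 1)
  rw [map_natCast] at h3
  rw [Nat.cast_succ] at h4
  exact (h2.trans_le (add_le_add_left h3 1)).not_ge h4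

/-- The isomorphism need not carry integers to integers, so `φ x` is the integer part of the image
of `x`. Distinct integers are at least `1` apart, which makes `φ` strictly increasing. -/
theorem haveIsoInitialSegments_of_ringEquiv (e : RobinsonField μ ≃+* RobinsonField ν) :
    HaveIsoInitialSegments (AboveOmega μ) (AboveOmega ν) := by
  have he : ∀ {u v : RobinsonField μ}, e u ≤ e v ↔ u ≤ v := e.robinsonField_le_iff
  have hfloor : ∀ x : tameInfinite μ, ∃ y : tameInfinite ν,
      tameClass y ≤ e (tameClass x) ∧ e (tameClass x) < tameClass y + 1 := fun x =>
    exists_tame_floor fun n => by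
      rw [← map_natCast e]
      exact he.2 (natCast_le_tameClass n x)
  choose φ hφ hφ' using hfloor
  have hmono : StrictMono φ := by
    intro x x' h
    by_contra! hcon
    have h1 := he.2 (tameClass_add_one_le h)
    rw [map_add, map_one] at h1
    exact (hφ' x').not_ge
      (((add_le_add_left ((tameClass_mono hcon).trans (hφ x)) 1)).trans h1)
  have huniq : ∀ x y, tameClass y ≤ e (tameClass x) → e (tameClass x) < tameClass y + 1 →
      φ x = y := by
    intro x y h h'
    rcases lt_trichotomy (φ x) y with hlt | heq | hlt
    · exact absurd ((tameClass_add_one_le hlt).trans h) (hφ' x).not_ge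
    · exact heq
    · exact absurd ((tameClass_add_one_le hlt).trans (hφ x)) h'.not_ge
  have hsurj : Function.Surjective φ := by
    intro y
    obtain ⟨x, hx, hx'⟩ := exists_tame_floor (u := e.symm (tameClass y)) fun n => by
      rw [← he, e.apply_symm_apply, map_natCast]
      exact natCast_le_tameClass n y
    rw [← he, e.apply_symm_apply] at hx
    rw [← not_le, ← he, e.apply_symm_apply, not_le, map_add, map_one] at hx'
    -- If the integer part `x` of the preimage of `y` falls strictly short of it, then `x + 1` is
    -- the element sent to `y`.
    rcases hx.eq_or_lt with h | h
    · exact ⟨x, huniq x y h.ge (h.trans_lt (lt_add_one _))⟩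
    · obtain ⟨x', hxx'⟩ := exists_succ x
      have : e (tameClass x') = e (tameClass x) + 1 := by rw [hxx', map_add, map_one]
      exact ⟨x', huniq x' y (this ▸ hx'.le) (this ▸ add_lt_add_left h 1)⟩
  exact ⟨_, _, tameInfinite_nonempty, tameInfinite_nonempty, isLowerSet_tameInfinite,
    isLowerSet_tameInfinite, ⟨hmono.orderIsoOfSurjective φ hsurj⟩⟩

end

/-! ### Counting the codes -/

/-- If `ℵ₂ ≤ 𝔠`, there is a family of at most `𝔠` regular cardinals between `ℵ₂` and `𝔠` with sum
at least `𝔠`, indexed by a regular cardinal between `ℵ₂` and `𝔠`. -/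
theorem exists_regular_family (h2 : ℵ_ 2 ≤ (𝔠 : Cardinal.{0})) :
    ∃ κ : Cardinal.{0}, κ.IsRegular ∧ ℵ_ 1 < κ ∧ κ ≤ 𝔠 ∧ ∃ l : κ.ord.ToType → Cardinal.{0},
      (∀ j, (l j).IsRegular ∧ ℵ_ 1 < l j ∧ l j ≤ 𝔠) ∧ 𝔠 ≤ Cardinal.sum l := by
  have h1 : ℵ_ 1 < (𝔠 : Cardinal.{0}) := aleph_one_lt_aleph_two.trans_le h2
  by_cases hreg : (𝔠 : Cardinal.{0}).IsRegular
  · refine ⟨ℵ_ 2, isRegular_aleph_two, aleph_one_lt_aleph_two, h2, fun _ => 𝔠,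
      fun _ => ⟨hreg, h1, le_rfl⟩, ?_⟩
    have : Nonempty Omega2 := inferInstance
    exact le_sum (fun _ => 𝔠) (Classical.arbitrary Omega2)
  · have hcof : (𝔠 : Cardinal.{0}).ord.cof < 𝔠 := not_le.1 fun h => hreg ⟨aleph0_le_continuum, h⟩
    -- For singular `𝔠`, successors of the sizes of the initial segments ending in a short cofinal
    -- set are regular, at most `𝔠`, and large enough in sum; the maximum with `ℵ₁` puts them above
    -- `ℵ₁`. The index set is enlarged to a regular cardinal by repetition.
    obtain ⟨s, hs, hsc⟩ := Order.exists_cof_eq (𝔠 : Cardinal.{0}).ord.ToType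
    rw [Ordinal.cof_toType] at hsc
    have hsucc : ∀ c : Cardinal.{0}, c < 𝔠 → (Order.succ (max c (ℵ_ 1))).IsRegular ∧
        ℵ_ 1 < Order.succ (max c (ℵ_ 1)) ∧ Order.succ (max c (ℵ_ 1)) ≤ 𝔠 := fun c hc =>
      ⟨isRegular_succ (aleph0_le_aleph 1 |>.trans (le_max_right _ _)),
        (le_max_right _ _).trans_lt (Order.lt_succ _), Order.succ_le_of_lt (max_lt hc h1)⟩
    obtain ⟨hκ, hκ1, hκ2⟩ := hsucc #s (hsc ▸ hcof)
    have hs0 : s.Nonempty := by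
      have : Nonempty (𝔠 : Cardinal.{0}).ord.ToType := nonempty_ord_toType continuum_ne_zero
      obtain ⟨y, hy, -⟩ := hs (Classical.arbitrary _)
      exact ⟨y, hy⟩
    have := hs0.to_subtype
    obtain ⟨f, hf⟩ : ∃ f : (Order.succ (max #s (ℵ_ 1))).ord.ToType → s, Function.Surjective f := by
      refine Function.exists_surjective_iff.2 ⟨?_, ?_⟩
      · exact ⟨fun _ => Classical.arbitrary _⟩
      · rw [← Cardinal.le_def, mk_ord_toType]
        exact (le_max_left _ _).trans (Order.le_succ _)
    have hIic : ∀ x : (𝔠 : Cardinal.{0}).ord.ToType, #(Iic x) < 𝔠 := by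
      intro x
      have hx := Cardinal.mk_Iio_lt x (by simp)
      rw [mk_ord_toType] at hx
      rw [← Iio_insert]
      exact mk_insert_le.trans_lt (add_lt_of_lt aleph0_le_continuum hx
        (one_lt_aleph0.trans aleph0_lt_continuum))
    refine ⟨_, hκ, hκ1, hκ2, fun j => Order.succ (max #(Iic (f j).1) (ℵ_ 1)),
      fun j => hsucc _ (hIic _), ?_⟩
    calc (𝔠 : Cardinal.{0}) = #((𝔠 : Cardinal.{0}).ord.ToType) := (mk_ord_toType _).symm
      _ = #(⋃ j, Iic (f j).1 : Set _) := by
          rw [eq_univ_of_forall (s := ⋃ j, Iic (f j).1), mk_univ]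
          intro x
          obtain ⟨y, hy, hxy⟩ := hs x
          obtain ⟨j, hj⟩ := hf ⟨y, hy⟩
          exact mem_iUnion.2 ⟨j, by rwa [hj]⟩
      _ ≤ _ := mk_iUnion_le_sum_mk
      _ ≤ _ := sum_le_sum _ _ fun j => (le_max_left _ _).trans (Order.le_succ _)

section

variable {X : Type} [LinearOrder X] [UncountableRegular X] {Θ : X → Type} [∀ i, LinearOrder (Θ i)]
  [∀ i, UncountableRegular (Θ i)]

/-- The bit `Z ⟨j, e⟩` is written at all `(δ, ε)` with `δ` of color `j` and `ε` of color `e`. Both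
color classes are stationary, so some such pair avoids the nonstationary sets on which
`Ladder.bits_eq` says nothing. -/
theorem exists_ultrafilter_family (h2 : ℵ_ 2 ≤ (𝔠 : Cardinal.{0})) (hX1 : ℵ_ 1 < #X) (hX : #X ≤ 𝔠)
    (hΘ1 : ∀ i, ℵ_ 1 < #(Θ i)) (hΘ : ∀ i, #(Θ i) ≤ 𝔠) :
    ∃ U : ((Σ i, Θ i) → Bool) → NonprincipalUltrafilter,
      ∀ Z Z', HaveIsoInitialSegments (AboveOmega (U Z)) (AboveOmega (U Z')) → Z = Z' := by
  obtain ⟨c, hc⟩ := exists_stationary_coloring hX1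
  choose d hd using fun i => exists_stationary_coloring (hΘ1 i)
  have hU := fun Z : (Σ i, Θ i) → Bool =>
    exists_ladder (Θ := fun i => Θ (c i)) hX (fun _ => hΘ _) h2 fun i ε => Z ⟨c i, d (c i) ε⟩
  choose U hU using hU
  refine ⟨U, fun Z Z' hiso => ?_⟩
  obtain ⟨A⟩ := hU Z
  obtain ⟨B⟩ := hU Z'
  obtain ⟨H, hH⟩ := A.bits_eq B hiso
  funext ⟨j, e⟩
  obtain ⟨δ, ⟨hδ, rfl⟩, hHδ⟩ := hc j H
  obtain ⟨H', hH'⟩ := hH δ hδ hHδ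
  obtain ⟨ε, ⟨hε, rfl⟩, hHε⟩ := hd (c δ) e H'
  exact hH' ε hε hHε

end

theorem mk_nonprincipalUltrafilter_le :
    #NonprincipalUltrafilter ≤ 2 ^ (2 ^ ℵ₀ : Cardinal.{0}) := by
  have h : Function.Injective fun μ : NonprincipalUltrafilter => (μ.1 : Filter ℕ).sets :=
    fun μ ν h => Subtype.ext (Ultrafilter.coe_injective (Filter.filter_eq h))
  simpa using mk_le_of_injective h

theorem haveIsoInitialSegments_refl (L : Type) [LinearOrder L] [Nonempty L] :
    HaveIsoInitialSegments L L :=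
  ⟨univ, univ, univ_nonempty, univ_nonempty, isLowerSet_univ, isLowerSet_univ, ⟨OrderIso.refl _⟩⟩

theorem mainTheorem6 (notCH : Cardinal.continuum.{0} ≠ Cardinal.aleph 1) :
    Cardinal.mk RobinsonIsoClass = 2 ^ (2 ^ Cardinal.aleph0.{0} : Cardinal.{0}) ∧
    ∃ S : Set NonprincipalUltrafilter,
      Cardinal.mk S = 2 ^ (2 ^ Cardinal.aleph0.{0} : Cardinal.{0}) ∧
      ∀ μ ∈ S, ∀ ν ∈ S, μ ≠ ν →
        IsEmpty (RobinsonField μ ≃+* RobinsonField ν) ∧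
        ¬ HaveIsoInitialSegments (AboveOmega μ) (AboveOmega ν) := by
  have h2 : ℵ_ 2 ≤ (𝔠 : Cardinal.{0}) := by
    have h1 : ℵ_ 1 < (𝔠 : Cardinal.{0}) := lt_of_le_of_ne aleph_one_le_continuum notCH.symm
    have := Order.succ_le_of_lt h1
    rwa [succ_aleph, one_add_one_eq_two] at this
  obtain ⟨κ, hκ, hκ1, hκ2, l, hl, hsum⟩ := exists_regular_family h2
  have := UncountableRegular.of_isRegular hκ (aleph0_lt_aleph_one.trans hκ1)
  have := fun j => UncountableRegular.of_isRegular (hl j).1 (aleph0_lt_aleph_one.trans (hl j).2.1)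
  obtain ⟨U, hU⟩ := exists_ultrafilter_family (X := κ.ord.ToType) (Θ := fun j => (l j).ord.ToType)
    h2 (by rwa [mk_ord_toType]) (by rwa [mk_ord_toType])
    (fun j => by rw [mk_ord_toType]; exact (hl j).2.1)
    (fun j => by rw [mk_ord_toType]; exact (hl j).2.2)
  -- The number of bits is the sum of the cardinals `l j`, which is at least `𝔠`.
  have hcode : 2 ^ (2 ^ ℵ₀ : Cardinal.{0}) ≤ #((Σ j, (l j).ord.ToType) → Bool) := by
    rw [← power_def, mk_bool, mk_sigma, two_power_aleph0]
    refine power_le_power_left two_ne_zero ?_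
    simpa only [mk_ord_toType] using hsum
  have hinj : Function.Injective U := fun Z Z' h => hU Z Z' (h ▸ haveIsoInitialSegments_refl _)
  refine ⟨le_antisymm (mk_quotient_le.trans mk_nonprincipalUltrafilter_le) ?_, range U,
    le_antisymm ((mk_set_le _).trans mk_nonprincipalUltrafilter_le) ?_, ?_⟩
  · refine hcode.trans (mk_le_of_injective (f := fun Z => Quotient.mk robinsonSetoid (U Z)) ?_)
    intro Z Z' h
    obtain ⟨e⟩ := Quotient.exact h
    exact hU Z Z' (haveIsoInitialSegments_of_ringEquiv e)
  · rw [mk_range_eq U hinj]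
    exact hcode
  · rintro _ ⟨Z, rfl⟩ _ ⟨Z', rfl⟩ hne
    have h : ¬ HaveIsoInitialSegments (AboveOmega (U Z)) (AboveOmega (U Z')) :=
      fun h => hne (congrArg U (hU Z Z' h))
    exact ⟨⟨fun e => h (haveIsoInitialSegments_of_ringEquiv e)⟩, h⟩
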